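/- Let $n\ge 1$ and $0<s<1<p<\infty$. Let $H:\mathbb R^n\to[0,\infty)$ be a Finsler--Minkowski norm: $H$ is convex with strictly convex unit ball $\{H\le 1\}$, $H\in C^1(\mathbb R^n\setminus\{0\})$, $H(x)=0$ iff $x=0$, $H(tx)=|t|H(x)$ for all $x\in\mathbb R^n$, $t\in\mathbb R$, and $C_1|x|\le H(x)\le C_2|x|$ for all $x$ with some constants $C_1,C_2>0$. Let $(\alpha,\beta)$ be one of $(1,0)$, $(1,\gamma)$ with $\gamma>0$, $(0,1)$. Let $f:\mathbb R\to\mathbb R$ be continuous with $|f(t)|\le C|t|^{p-1}$ for all $t\in\mathbb R$ and some constant $C>0$, and put $F(t)=\int_0^t f(\tau)\,d\tau$. Let $W^{1,p}(\mathbb R^n)$ be the space of $u\in L^p(\mathbb R^n)$ with weak gradient $\nabla u$ in $L^p$, and $W^{s,p}(\mathbb R^n)$ the space of $u\in L^p(\mathbb R^n)$ with $$[u]_{s,p}^p=\int_{\mathbb R^n}\int_{\mathbb R^n}\frac{|u(x)-u(y)|^p}{|x-y|^{n+sp}}\,dx\,dy<\infty .$$ Let $C^{0,l}(\mathbb R^n)$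 be the functions that are Hölder continuous with exponent $l$ on every compact set, and $C^{1,1}(\mathbb R^n)$ the $C^1$ functions whose gradient is Lipschitz on every compact set (in particular, globally Hölder functions, respectively $C^1$ functions with globally Lipschitz gradient, are included). Define $$X_{\alpha,\beta}=\begin{cases}W^{1,p}(\mathbb R^n), & (\alpha,\beta)=(1,0),\\ \{u\in W^{1,p}(\mathbb R^n)\cap W^{s,p}(\mathbb R^n): u\in C^{0,l}(\mathbb R^n)\text{ for some } l\in(s,1]\}, & (\alpha,\beta)=(1,\gamma),\ \gamma>0,\\ \big(W^{s,p}(\mathbb R^n)\cap C^{1,1}(\mathbb R^n)\big)\cup\big(W^{1,p}(\mathbb R^n)\cap W^{s,p}(\mathbb R^n)\big), & (\alpha,\beta)=(0,1).\end{cases}$$ Let $u\in X_{\alpha,\beta}$ be a weak solution of $-\alpha H_pu+\beta(-\Delta_p)^su=f(u)$ in $\mathbb R^n$, where $H_pu=\operatorname{div}\big(H(\nabla u)^{p-1}\nabla_\xi H(\nabla u)\big)$ and $(-\Delta_p)^s$ is the fractional $p$-Laplacian; that is, for every $\phi\in C_c^1(\mathbb R^n)$, $$\alpha\int_{\mathbb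 R^n}H(\nabla u)^{p-1}\nabla_\xi H(\nabla u)\cdot\nabla\phi\,dx+\beta\int_{\mathbb R^n}\int_{\mathbb R^n}\frac{|u(x)-u(y)|^{p-2}(u(x)-u(y))(\phi(x)-\phi(y))}{|x-y|^{n+sp}}\,dx\,dy=\int_{\mathbb R^n}f(u)\phi\,dx ,$$ where a term with coefficient $0$ is absent. Then $F(u)\in L^1(\mathbb R^n)$ and $$\frac{\alpha(n-p)}{p}\int_{\mathbb R^n}H(\nabla u)^p\,dx+\frac{\beta(n-sp)}{p}[u]_{s,p}^p=n\int_{\mathbb R^n}F(u)\,dx ,$$ again with terms of coefficient $0$ absent. -/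

import Mathlib

open MeasureTheory Set
open scoped NNReal ContDiff RealInnerProductSpace

noncomputable section

namespace Pohozaev

/-- The Euclidean space `ℝⁿ`. -/
abbrev E (n : ℕ) : Type := EuclideanSpace ℝ (Fin n)

/-- Finsler-Minkowski norms on `ℝⁿ`. A positively homogeneous function is affine along rays, so
strict convexity is understood, as usual for norms, as convexity of `H` together with strict
convexity of its unit ball. -/
structure IsFinslerMinkowskiNorm {n : ℕ} (H : E n → ℝ) : Prop where
  nonneg : ∀ ξ, 0 ≤ H ξ
  contDiffOn : ContDiffOn ℝ 1 H {0}ᶜ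
  convex : ConvexOn ℝ univ H
  strictConvex_ball : StrictConvex ℝ {ξ : E n | H ξ ≤ 1}
  eq_zero_iff : ∀ ξ, H ξ = 0 ↔ ξ = 0
  homogeneous : ∀ (t : ℝ) (ξ : E n), H (t • ξ) = |t| * H ξ
  bounds : ∃ C₁ C₂ : ℝ, 0 < C₁ ∧ 0 < C₂ ∧ ∀ ξ, C₁ * ‖ξ‖ ≤ H ξ ∧ H ξ ≤ C₂ * ‖ξ‖

/-- `G` is a weak (distributional) gradient of `u` on `ℝⁿ`. -/
def IsWeakGradient {n : ℕ} (u : E n → ℝ) (G : E n → E n) : Prop :=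
  LocallyIntegrable u ∧ LocallyIntegrable G ∧
    ∀ φ : E n → ℝ, ContDiff ℝ ∞ φ → HasCompactSupport φ → ∀ i : Fin n,
      ∫ x, u x * fderiv ℝ φ x (EuclideanSpace.single i 1) = - ∫ x, G x i * φ x

open Classical in
/-- The weak gradient of `u` (unique up to null sets), and `0` if there is none. -/
def weakGradient {n : ℕ} (u : E n → ℝ) : E n → E n :=
  if h : ∃ G, IsWeakGradient u G then h.choose else 0

/-- The Sobolev space `W^{1,p}(ℝⁿ)`. -/
def sobolevW1 (n : ℕ) (p : ℝ) : Set (E n → ℝ) :=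
  {u | MemLp u (ENNReal.ofReal p) ∧
    ∃ G, IsWeakGradient u G ∧ MemLp G (ENNReal.ofReal p)}

/-- The fractional Sobolev space `W^{s,p}(ℝⁿ)`. -/
def sobolevWs (n : ℕ) (s p : ℝ) : Set (E n → ℝ) :=
  {u | MemLp u (ENNReal.ofReal p) ∧
    MemLp (fun z : E n × E n => |u z.1 - u z.2| / ‖z.1 - z.2‖ ^ ((n : ℝ) / p + s))
      (ENNReal.ofReal p) (volume : Measure (E n × E n))}

/-- Hölder continuity with exponent `l` on every compact set. -/
def IsLocallyHolder {n : ℕ} {F : Type*} [NormedAddCommGroup F] (l : ℝ≥0) (g : E n → F) : Prop :=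
  ∀ K : Set (E n), IsCompact K → ∃ C : ℝ≥0, HolderOnWith C l g K

/-- The Hölder class `C^{0,l}(ℝⁿ)`, with the estimate required on compact sets only. -/
def holderC0 (n : ℕ) (l : ℝ≥0) : Set (E n → ℝ) := {u | IsLocallyHolder l u}

/-- The class `C^{1,1}(ℝⁿ)`, with the Lipschitz estimate for the derivative required on compact
sets only. -/
def holderC11 (n : ℕ) : Set (E n → ℝ) := {u | ContDiff ℝ 1 u ∧ IsLocallyHolder 1 (fderiv ℝ u)}

/-- The admissible pairs `(α, β)`: `(1, 0)`, `(1, γ)` with `γ > 0`, and `(0, 1)`. -/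
def admissible : Set (ℝ × ℝ) :=
  {c | c = (1, 0) ∨ (∃ γ : ℝ, 0 < γ ∧ c = (1, γ)) ∨ c = (0, 1)}

/-- The solution space `X_{α,β}`. -/
def solutionSpace (n : ℕ) (s p α β : ℝ) : Set (E n → ℝ) :=
  {u | (α = 1 ∧ β = 0 ∧ u ∈ sobolevW1 n p) ∨
    (α = 1 ∧ 0 < β ∧ u ∈ sobolevW1 n p ∩ sobolevWs n s p ∧
      ∃ l : ℝ≥0, s < l ∧ l ≤ 1 ∧ u ∈ holderC0 n l) ∨
    (α = 0 ∧ β = 1 ∧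
      u ∈ (sobolevWs n s p ∩ holderC11 n) ∪ (sobolevW1 n p ∩ sobolevWs n s p))}

/-- `J_p(r) = |r|^{p-2} r`. -/
def J (p r : ℝ) : ℝ := |r| ^ (p - 2) * r

/-- `‖H(∇u)‖_p^p`. -/
def anisotropicEnergy {n : ℕ} (H : E n → ℝ) (p : ℝ) (u : E n → ℝ) : ℝ :=
  ∫ x, H (weakGradient u x) ^ p

/-- `[u]_{s,p}^p`. -/
def gagliardoEnergy {n : ℕ} (s p : ℝ) (u : E n → ℝ) : ℝ :=
  ∫ z : E n × E n, |u z.1 - u z.2| ^ p / ‖z.1 - z.2‖ ^ ((n : ℝ) + s * p)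

/-- `u` satisfies the weak formulation of `-α H_p u + β (-Δ_p)^s u = f(u)` in `ℝⁿ`, tested with
all functions in `C_c^1(ℝⁿ)`. -/
def IsWeakSolution {n : ℕ} (H : E n → ℝ) (s p α β : ℝ) (f : ℝ → ℝ) (u : E n → ℝ) : Prop :=
  ∀ φ : E n → ℝ, ContDiff ℝ 1 φ → HasCompactSupport φ →
    α * (∫ x, H (weakGradient u x) ^ (p - 1) *
        ⟪gradient H (weakGradient u x), gradient φ x⟫) +
      β * (∫ z : E n × E n, J p (u z.1 - u z.2) * (φ z.1 - φ z.2) /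
        ‖z.1 - z.2‖ ^ ((n : ℝ) + s * p)) =
      ∫ x, f (u x) * φ x

end Pohozaev

end

open Pohozaev

/-!
The identity is the stationarity of the energy under dilations, made rigorous for weak solutions by
convexity. Let `𝓔(v) = α/p ∫ H(∇v)^p + β/p [v]^p` and `F(t) = ∫_0^t f`. Formally one differentiates
`𝓔` and `∫ F` along `u_t(x) = u((1 + t) x)`: the integrals of `H(∇u_t)^p`, of the Gagliardo density
and of `F(u_t)` scale like `(1 + t)^(p - n)`, `(1 + t)^(s p - n)` and `(1 + t)^(-n)`, and the
equation says that `𝓔` and `∫ F` have the same derivative.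

The displacement `u_t - u` has the size of `|x| |∇u|`, which need not lie in `L^p`, so the dilations
are truncated: `deform R t` is the dilation by `1 + t` on the ball of radius `R`, the identity off
the ball of radius `2 R`, and differs from the identity by `O(|t|)` in `C¹`-seminorm uniformly in
`R` (`DeformBound`). With `Φ = deform R t` and `v = u ∘ Φ`, four facts give the identity.

* Convexity of `H^p` and of `|·|^p` gives `𝓔(v) - 𝓔(u) ≥ 𝓔'(u)(v - u)`
  (`mul_integral_finsler_le`, `mul_integral_J_le`). No second derivatives of `H` or `u` enter.
* The equation gives `𝓔'(u)(v - u) = ∫ f(u) (v - u)`. If `u` is `C¹`, then `v - u` is itself a test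
  function; if `u` lies in `W^{1,p}`, one tests with `u_k ∘ Φ - u_k` for mollifications `u_k` of `u`
  and passes to the limit (`IsWeakSolution.test_deform_of_contDiff`,
  `IsWeakSolution.test_deform_of_mem_sobolevW1`). This needs no chain rule for weak gradients:
  only the pulled-back field `DΦᵀ (∇u ∘ Φ)` occurs.
* Since `‖v - u‖_p = O(|t|)` for fixed `R`, and `v = u` off a ball,
  `∫ F(v) - ∫ F(u) = ∫ f(u) (v - u) + o(t)`
  (`exists_abs_integral_primitive_comp_deform_sub_le`).
* By change of variables, `∫ H(DΦᵀ (∇u ∘ Φ))^p`, `[v]^p` and `∫ F(v)` have the same first-order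
  expansion in `t` as under exact dilations, up to an error `ε |t|` if `R` is large: outside a large
  ball the relative error is still `O(|t|)` uniformly in `R`, and the mass there is small
  (`exists_abs_integral_sub_le_of_dilation_on_ball`).

Together these give `t (L + n ∫ F(u)) ≥ -C ε |t|` for small `t` of both signs, where `L` is the
derivative of `𝓔` under exact dilations. Hence `L = -n ∫ F(u)`.
-/

noncomputable section

namespace Pohozaev

open Filter Topology

/-! ### Averages and translations in `L^p` -/

theorem lintegral_rpow_le_of_isProbabilityMeasure {A : Type*} [MeasurableSpace A] (ν : Measure A)
    [IsProbabilityMeasure ν] {p : ℝ} (hp : 1 ≤ p) {g : A → ENNReal} (hg : AEMeasurable g ν) :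
    (∫⁻ a, g a ∂ν) ^ p ≤ ∫⁻ a, g a ^ p ∂ν := by
  have hp0 : 0 < p := by linarith
  have h := eLpNorm'_le_eLpNorm'_of_exponent_le (ε := ENNReal) (f := g) one_pos hp ν
    (hg.aestronglyMeasurable)
  simp only [eLpNorm', ENNReal.rpow_one, one_div, inv_one, enorm_eq_self] at h
  calc (∫⁻ a, g a ∂ν) ^ p ≤ ((∫⁻ a, g a ^ p ∂ν) ^ p⁻¹) ^ p := by gcongr
    _ = _ := by rw [← ENNReal.rpow_mul, inv_mul_cancel₀ hp0.ne', ENNReal.rpow_one]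

/-- Minkowski's integral inequality for averages: if almost every `k (h, ·)` has `L^p` seminorm at
most `ε`, so does the average over `h`. -/
theorem eLpNorm_average_le {A Y F : Type*} [MeasurableSpace A] [MeasurableSpace Y]
    [NormedAddCommGroup F] [NormedSpace ℝ F] (ν : Measure A) [IsProbabilityMeasure ν]
    (μ : Measure Y) [SFinite μ] {p : ℝ} (hp : 1 ≤ p) {k : A × Y → F}
    (hk : AEStronglyMeasurable k (ν.prod μ)) {ε : ENNReal}
    (hε : ∀ᵐ h ∂ν, eLpNorm (fun y => k (h, y)) (ENNReal.ofReal p) μ ≤ ε) :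
    eLpNorm (fun y => ∫ h, k (h, y) ∂ν) (ENNReal.ofReal p) μ ≤ ε := by
  have hp0 : 0 < p := by linarith
  have hq0 : ENNReal.ofReal p ≠ 0 := by simpa using hp0
  have hqt : ENNReal.ofReal p ≠ ⊤ := ENNReal.ofReal_ne_top
  have hq : (ENNReal.ofReal p).toReal = p := ENNReal.toReal_ofReal hp0.le
  have hpow : ∀ (g : Y → F), eLpNorm g (ENNReal.ofReal p) μ ≤ ε ↔ ∫⁻ y, ‖g y‖ₑ ^ p ∂μ ≤ ε ^ p := by
    intro g
    rw [eLpNorm_eq_lintegral_rpow_enorm_toReal hq0 hqt, hq, one_div,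
      ENNReal.rpow_inv_le_iff hp0]
  rw [hpow]
  calc ∫⁻ y, ‖∫ h, k (h, y) ∂ν‖ₑ ^ p ∂μ
      ≤ ∫⁻ y, ∫⁻ h, ‖k (h, y)‖ₑ ^ p ∂ν ∂μ := by
        apply lintegral_mono_ae
        filter_upwards [hk.prod_swap.prodMk_left] with y hy
        refine le_trans ?_ (lintegral_rpow_le_of_isProbabilityMeasure ν hp hy.enorm)
        gcongr
        exact enorm_integral_le_lintegral_enorm _
    _ = ∫⁻ h, ∫⁻ y, ‖k (h, y)‖ₑ ^ p ∂μ ∂ν := by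
        rw [lintegral_lintegral_swap]
        exact (hk.prod_swap.enorm.pow_const p)
    _ ≤ ∫⁻ h, ε ^ p ∂ν := by
        apply lintegral_mono_ae
        filter_upwards [hε] with h hh
        exact (hpow _).1 hh
    _ = ε ^ p := by simp

/-- Translations act continuously on `L^p`. -/
theorem tendsto_eLpNorm_translate_sub {Y F : Type*} [NormedAddCommGroup Y] [MeasurableSpace Y]
    [BorelSpace Y] [SecondCountableTopology Y] [LocallyCompactSpace Y]
    (μ : Measure Y) [μ.IsAddHaarMeasure]
    [NormedAddCommGroup F] {q : ENNReal} (hq1 : 1 ≤ q) (hq : q ≠ ⊤) {g : Y → F}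
    (hg : MemLp g q μ) :
    Tendsto (fun h : Y => eLpNorm (fun y => g (y - h) - g y) q μ) (𝓝 0) (𝓝 0) := by
  have : Fact (1 ≤ q) := ⟨hq1⟩
  have : Fact (q ≠ ⊤) := ⟨hq⟩
  have : μ.InnerRegularCompactLTTop := inferInstance
  have hc : Continuous (fun h : Y => (DomAddAct.mk (-h)) +ᵥ (hg.toLp g)) := by
    have h1 : Continuous (fun h : Y => DomAddAct.mk (-h)) :=
      DomAddAct.mkHomeomorph.continuous.comp continuous_neg
    exact h1.vadd continuous_const
  have h2 : Tendsto (fun h : Y => edist ((DomAddAct.mk (-h)) +ᵥ (hg.toLp g)) (hg.toLp g))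
      (𝓝 0) (𝓝 0) := by
    have := (hc.edist (continuous_const (y := hg.toLp g))).tendsto 0
    simpa using this
  refine h2.congr fun h => ?_
  rw [DomAddAct.mk_vadd_toLp, Lp.edist_toLp_toLp]
  refine eLpNorm_congr_ae (Eventually.of_forall fun y => ?_)
  simp [sub_eq_neg_add]

/-! ### Mollification and weak gradients -/

/-- The probability measure on `ℝⁿ` with density the normalised bump `φ`. -/
def bumpMeasure {n : ℕ} (φ : ContDiffBump (0 : E n)) : Measure (E n) :=
  volume.withDensity fun h => ENNReal.ofReal (φ.normed volume h)

instance {n : ℕ} (φ : ContDiffBump (0 : E n)) : IsProbabilityMeasure (bumpMeasure φ) := by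
  constructor
  rw [bumpMeasure, withDensity_apply _ MeasurableSet.univ, Measure.restrict_univ,
    ← ofReal_integral_eq_lintegral_ofReal φ.integrable_normed
      (Eventually.of_forall fun x => φ.nonneg_normed x), φ.integral_normed, ENNReal.ofReal_one]

theorem integral_bumpMeasure {n : ℕ} (φ : ContDiffBump (0 : E n)) {F : Type*}
    [NormedAddCommGroup F] [NormedSpace ℝ F] (g : E n → F) :
    ∫ h, g h ∂(bumpMeasure φ) = ∫ h, φ.normed volume h • g h := by
  rw [bumpMeasure, integral_withDensity_eq_integral_toReal_smul]
  · exact integral_congr_ae (Eventually.of_forall fun h => by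
      simp only [ENNReal.toReal_ofReal (φ.nonneg_normed h)])
  · exact φ.continuous_normed.measurable.ennreal_ofReal
  · exact Eventually.of_forall fun h => ENNReal.ofReal_lt_top

theorem ae_bumpMeasure_mem_ball {n : ℕ} (φ : ContDiffBump (0 : E n)) :
    ∀ᵐ h ∂(bumpMeasure φ), h ∈ Metric.ball (0 : E n) φ.rOut := by
  rw [bumpMeasure, ae_withDensity_iff φ.continuous_normed.measurable.ennreal_ofReal]
  refine Eventually.of_forall fun h hh => ?_
  rw [← φ.support_normed_eq (μ := volume)]
  intro h0
  simp [h0] at hh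

/-- Mollification converges in `L^p`. The mollification is over shifts by `ι h`, with `h` small
in `ℝⁿ`, so that it covers the diagonal shifts of `ℝⁿ × ℝⁿ` as well. -/
theorem tendsto_eLpNorm_mollify_sub {n : ℕ} {Y F : Type*} [NormedAddCommGroup Y]
    [MeasurableSpace Y] [BorelSpace Y] [SecondCountableTopology Y] [LocallyCompactSpace Y]
    (μ : Measure Y) [μ.IsAddHaarMeasure] [NormedAddCommGroup F] [NormedSpace ℝ F]
    [CompleteSpace F]
    {p : ℝ} (hp : 1 ≤ p) {g : Y → F} (hg : MemLp g (ENNReal.ofReal p) μ)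
    {ι : E n → Y} (hι : Continuous ι) (hι0 : ι 0 = 0)
    {φ : ℕ → ContDiffBump (0 : E n)} (hφ : Tendsto (fun k => (φ k).rOut) atTop (𝓝 0)) :
    Tendsto (fun k => eLpNorm (fun y => (∫ h, (φ k).normed volume h • g (y - ι h)) - g y)
      (ENNReal.ofReal p) μ) atTop (𝓝 0) := by
  have hp0 : 0 < p := by linarith
  have hq0 : ENNReal.ofReal p ≠ 0 := by simpa using hp0
  have hqt : ENNReal.ofReal p ≠ ⊤ := ENNReal.ofReal_ne_top
  have hq1 : 1 ≤ ENNReal.ofReal p := by simpa using hp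
  have hT := tendsto_eLpNorm_translate_sub μ hq1 hqt hg
  have hT' : Tendsto (fun h : E n => eLpNorm (fun y => g (y - ι h) - g y) (ENNReal.ofReal p) μ)
      (𝓝 0) (𝓝 0) := hT.comp (by simpa [hι0] using hι.tendsto 0)
  -- on the support of a small bump every single shift is `ε`-close to the identity in `L^p`
  rw [ENNReal.tendsto_atTop_zero]
  intro ε hε
  have hev : ∀ᶠ h in 𝓝 (0 : E n),
      eLpNorm (fun y => g (y - ι h) - g y) (ENNReal.ofReal p) μ ≤ ε := hT'.eventually_le_const hε
  obtain ⟨δ, hδ, hball⟩ := Metric.eventually_nhds_iff_ball.1 hev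
  obtain ⟨K, hK⟩ := eventually_atTop.1 (hφ.eventually_lt_const hδ)
  refine ⟨K, fun k hk => ?_⟩
  set ν := bumpMeasure (φ k) with hν
  have hmp : MeasurePreserving (fun z : E n × Y => (z.1, z.2 - ι z.1)) (ν.prod μ) (ν.prod μ) := by
    refine (MeasurePreserving.id ν).skew_product (g := fun h y => y - ι h) ?_ ?_
    · exact (measurable_snd.sub (hι.measurable.comp measurable_fst))
    · exact Eventually.of_forall fun h => map_sub_right_eq_self μ (ι h)
  have hgs : MemLp (fun z : E n × Y => g (z.2 - ι z.1)) (ENNReal.ofReal p) (ν.prod μ) :=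
    (hg.comp_snd ν).comp_measurePreserving hmp
  have hk1 : AEStronglyMeasurable (fun z : E n × Y => g (z.2 - ι z.1) - g z.2) (ν.prod μ) :=
    hgs.1.sub (hg.comp_snd ν).1
  have hJ := eLpNorm_average_le ν μ hp hk1 (ε := ε) (by
    filter_upwards [ae_bumpMeasure_mem_ball (φ k)] with h hh
    exact hball h (Metric.ball_subset_ball (hK k hk).le hh))
  refine le_trans (le_of_eq (eLpNorm_congr_ae ?_)) hJ
  -- almost every orbit average converges absolutely, so the constant `g y` may be taken out
  have hint : Integrable (fun z : E n × Y => ‖g (z.2 - ι z.1)‖ ^ p) (ν.prod μ) := by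
    have := hgs.integrable_norm_rpow hq0 hqt
    rwa [ENNReal.toReal_ofReal hp0.le] at this
  filter_upwards [hint.prod_left_ae, hgs.1.prod_swap.prodMk_left] with y hy hym
  have hmem : MemLp (fun h => g (y - ι h)) (ENNReal.ofReal p) ν := by
    have hym' : AEStronglyMeasurable (fun h => g (y - ι h)) ν := hym
    rw [← integrable_norm_rpow_iff hym' hq0 hqt, ENNReal.toReal_ofReal hp0.le]
    exact hy
  have hi : Integrable (fun h => g (y - ι h)) ν := hmem.integrable hq1
  rw [integral_sub hi (integrable_const _), integral_bumpMeasure]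
  simp

/-- The mollification of `g` with the normalised bump `φ`. -/
def mollify {n : ℕ} {F : Type*} [NormedAddCommGroup F] [NormedSpace ℝ F]
    (φ : ContDiffBump (0 : E n)) (g : E n → F) (x : E n) : F :=
  ∫ h, φ.normed volume h • g (x - h)

theorem integrable_mollify_integrand {n : ℕ} {F : Type*} [NormedAddCommGroup F] [NormedSpace ℝ F]
    (φ : ContDiffBump (0 : E n)) {g : E n → F} (hg : LocallyIntegrable g) (x : E n) :
    Integrable (fun h => φ.normed volume h • g (x - h)) :=
  φ.hasCompactSupport_normed.convolutionExists_left (ContinuousLinearMap.lsmul ℝ ℝ)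
    φ.continuous_normed hg x

theorem contDiff_mollify {n : ℕ} (φ : ContDiffBump (0 : E n)) {g : E n → ℝ}
    (hg : LocallyIntegrable g) : ContDiff ℝ 1 (mollify φ g) :=
  φ.hasCompactSupport_normed.contDiff_convolution_left (n := 1) (ContinuousLinearMap.lsmul ℝ ℝ)
    φ.contDiff_normed hg

theorem mollify_apply_coord {n : ℕ} (φ : ContDiffBump (0 : E n)) {G : E n → E n}
    (hG : LocallyIntegrable G) (x : E n) (i : Fin n) :
    mollify φ G x i = ∫ h, φ.normed volume h * G (x - h) i := by
  have := (EuclideanSpace.proj (𝕜 := ℝ) i).integral_comp_comm (integrable_mollify_integrand φ hG x)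
  simpa [mollify] using this.symm

/-- Differentiating the kernel and using the definition of the weak gradient with the translated
kernel as test function. -/
theorem gradient_mollify {n : ℕ} (φ : ContDiffBump (0 : E n)) {u : E n → ℝ} {G : E n → E n}
    (h : IsWeakGradient u G) (x : E n) : gradient (mollify φ u) x = mollify φ G x := by
  obtain ⟨hu, hG, hw⟩ := h
  ext i
  rw [mollify_apply_coord φ hG]
  have h1 : gradient (mollify φ u) x i = fderiv ℝ (mollify φ u) x (EuclideanSpace.single i 1) := by
    rw [← inner_gradient_left, EuclideanSpace.inner_single_right]
    simp
  have hφ1 : ContDiff ℝ 1 (φ.normed volume) := φ.contDiff_normed (n := 1)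
  have h2 : HasFDerivAt (mollify φ u) _ x :=
    φ.hasCompactSupport_normed.hasFDerivAt_convolution_left (ContinuousLinearMap.lsmul ℝ ℝ)
      hφ1 hu x
  rw [h1, h2.fderiv]
  have h3 : Integrable (fun t => ((ContinuousLinearMap.lsmul ℝ ℝ).precompL (E n)
      (fderiv ℝ (φ.normed volume) t)) (u (x - t))) :=
    (φ.hasCompactSupport_normed.fderiv ℝ).convolutionExists_left _
      (hφ1.continuous_fderiv one_ne_zero) hu x
  have h5 := ContinuousLinearMap.integral_apply h3 (EuclideanSpace.single i (1 : ℝ))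
  rw [convolution_def]
  refine h5.trans ?_
  simp only [ContinuousLinearMap.precompL_apply, ContinuousLinearMap.lsmul_apply, smul_eq_mul]
  have hψ : ContDiff ℝ ∞ (fun y => φ.normed volume (x - y)) :=
    (φ.contDiff_normed (n := ⊤)).comp (contDiff_const.sub contDiff_id)
  have hψc : HasCompactSupport (fun y => φ.normed volume (x - y)) :=
    φ.hasCompactSupport_normed.comp_homeomorph (Homeomorph.subLeft x)
  have h4 := hw _ hψ hψc i
  have hfd : ∀ y, fderiv ℝ (fun y => φ.normed volume (x - y)) y (EuclideanSpace.single i 1) =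
      - fderiv ℝ (φ.normed volume) (x - y) (EuclideanSpace.single i 1) := by
    intro y
    have hd := (((hφ1.differentiable one_ne_zero) (x - y)).hasFDerivAt).comp y
      ((hasFDerivAt_id y).const_sub x)
    have e := hd.fderiv
    change fderiv ℝ (fun y => φ.normed volume (x - y)) y = _ at e
    rw [e]
    simp
  simp only [hfd] at h4
  rw [← integral_sub_left_eq_self (fun t => φ.normed volume t * G (x - t) i) volume x,
    ← integral_sub_left_eq_self (fun t => fderiv ℝ (φ.normed volume) t
      (EuclideanSpace.single i 1) * u (x - t)) volume x]
  simp only [sub_sub_cancel, mul_neg, integral_neg, neg_inj] at h4 ⊢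
  simpa only [mul_comm] using h4

theorem IsWeakGradient.ae_eq {n : ℕ} {u : E n → ℝ} {G G' : E n → E n} (h : IsWeakGradient u G)
    (h' : IsWeakGradient u G') : G =ᵐ[volume] G' := by
  have key : ∀ i, ∀ᵐ x, G x i - G' x i = 0 := by
    intro i
    have hc : ∀ {G : E n → E n}, LocallyIntegrable G → LocallyIntegrable fun x => G x i :=
      fun {G} hG => by
        intro x
        obtain ⟨s, hs, hi⟩ := hG x
        exact ⟨s, hs, (EuclideanSpace.proj (𝕜 := ℝ) i).integrable_comp hi⟩
    apply ae_eq_zero_of_integral_contDiff_smul_eq_zero ((hc h.2.1).sub (hc h'.2.1))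
    intro g hg hgc
    have e : ∫ x, G x i * g x = ∫ x, G' x i * g x := by
      have := (h.2.2 g hg hgc i).symm.trans (h'.2.2 g hg hgc i)
      exact neg_inj.1 this
    have i1 := (hc h.2.1).integrable_smul_left_of_hasCompactSupport hg.continuous hgc
    have i2 := (hc h'.2.1).integrable_smul_left_of_hasCompactSupport hg.continuous hgc
    simp only [Pi.sub_apply, smul_eq_mul, mul_sub] at i1 i2 ⊢
    rw [integral_sub i1 i2]
    simp only [mul_comm (g _)]
    rw [e, sub_self]
  filter_upwards [ae_all_iff.2 key] with x hx
  ext i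
  exact sub_eq_zero.1 (hx i)

theorem isWeakGradient_weakGradient {n : ℕ} {p : ℝ} {u : E n → ℝ} (h : u ∈ sobolevW1 n p) :
    IsWeakGradient u (weakGradient u) ∧ MemLp (weakGradient u) (ENNReal.ofReal p) := by
  obtain ⟨-, G, hG, hGp⟩ := h
  have he : ∃ G, IsWeakGradient u G := ⟨G, hG⟩
  have h1 : IsWeakGradient u (weakGradient u) := by
    rw [weakGradient, dif_pos he]
    exact he.choose_spec
  exact ⟨h1, hGp.ae_eq (hG.ae_eq h1)⟩

/-! ### Truncated dilations -/

theorem differentiable_det {n : ℕ} : Differentiable ℝ (fun A : E n →L[ℝ] E n => A.det) := by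
  have h : (fun A : E n →L[ℝ] E n => A.det) = fun A => ∑ σ : Equiv.Perm (Fin n),
      ((Equiv.Perm.sign σ : ℤ) : ℝ) * ∏ i, EuclideanSpace.proj (𝕜 := ℝ) (σ i)
        (A (EuclideanSpace.single i (1 : ℝ))) := by
    funext A
    rw [ContinuousLinearMap.det,
      ← LinearMap.det_toMatrix (EuclideanSpace.basisFun (Fin n) ℝ).toBasis, Matrix.det_apply']
    simp [LinearMap.toMatrix_apply]
  rw [h]
  fun_prop

/-- The determinant is Lipschitz near the identity. -/
theorem exists_abs_det_sub_one_le (n : ℕ) : ∃ C > 0, ∃ δ > 0, ∀ A : E n →L[ℝ] E n,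
    ‖A - 1‖ ≤ δ → |A.det - 1| ≤ C * ‖A - 1‖ := by
  have h := (differentiable_det (n := n) 1).hasFDerivAt.isBigO_sub
  obtain ⟨C, hC, hb⟩ := h.exists_pos
  have hb := hb.bound
  obtain ⟨δ, hδ, hb⟩ := Metric.eventually_nhds_iff_ball.1 hb
  refine ⟨C, hC, δ / 2, by positivity, fun A hA => ?_⟩
  have := hb A (by rw [mem_ball_iff_norm]; linarith)
  simpa [ContinuousLinearMap.det] using this

/-- A fixed smooth cut-off on `ℝⁿ`: it is `1` on the unit ball and `0` off the ball of radius
`2`. -/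
def cutoff (n : ℕ) : ContDiffBump (0 : E n) where
  rIn := 1
  rOut := 2
  rIn_pos := one_pos
  rIn_lt_rOut := one_lt_two

/-- The radial vector field `x`, cut off outside a ball of radius comparable to `R`. -/
def radialField {n : ℕ} (R : ℝ) (x : E n) : E n := cutoff n (R⁻¹ • x) • x

/-- The map `x ↦ x + t X_R(x)` that follows the truncated radial field `X_R` for time `t`; it is
the dilation by `1 + t` near the origin and the identity far away. -/
def deform {n : ℕ} (R t : ℝ) (x : E n) : E n := x + t • radialField R x

/-- The derivative of `deform R t`. -/
def deformDeriv {n : ℕ} (R t : ℝ) (x : E n) : E n →L[ℝ] E n :=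
  1 + t • fderiv ℝ (radialField (n := n) 1) (R⁻¹ • x)

theorem contDiff_radialField_one {n : ℕ} : ContDiff ℝ ∞ (radialField (n := n) 1) := by
  have e : radialField (n := n) 1 = fun x => cutoff n x • x := by funext x; simp [radialField]
  rw [e]
  exact (cutoff n).contDiff.smul contDiff_id

theorem radialField_eq_smul {n : ℕ} {R : ℝ} (hR : 0 < R) (x : E n) :
    radialField R x = R • radialField 1 (R⁻¹ • x) := by
  simp only [radialField, inv_one, one_smul]
  rw [smul_comm R, smul_smul R, mul_inv_cancel₀ hR.ne', one_smul]

theorem radialField_of_norm_le {n : ℕ} {R : ℝ} (hR : 0 < R) {x : E n} (hx : ‖x‖ ≤ R) :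
    radialField R x = x := by
  have : cutoff n (R⁻¹ • x) = 1 := by
    apply (cutoff n).one_of_mem_closedBall
    rw [mem_closedBall_zero_iff, norm_smul, norm_inv, Real.norm_of_nonneg hR.le]
    change R⁻¹ * ‖x‖ ≤ 1
    rwa [inv_mul_le_iff₀ hR, mul_one]
  rw [radialField, this, one_smul]

theorem radialField_of_le_norm {n : ℕ} {R : ℝ} (hR : 0 < R) {x : E n} (hx : 2 * R ≤ ‖x‖) :
    radialField R x = 0 := by
  have : cutoff n (R⁻¹ • x) = 0 := by
    apply (cutoff n).zero_of_le_dist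
    rw [dist_zero_right, norm_smul, norm_inv, Real.norm_of_nonneg hR.le]
    change 2 ≤ R⁻¹ * ‖x‖
    rw [le_inv_mul_iff₀ hR]; linarith
  rw [radialField, this, zero_smul]

theorem hasFDerivAt_radialField {n : ℕ} {R : ℝ} (hR : 0 < R) (x : E n) :
    HasFDerivAt (radialField R) (fderiv ℝ (radialField (n := n) 1) (R⁻¹ • x)) x := by
  have h1 : HasFDerivAt (radialField (n := n) 1) (fderiv ℝ (radialField (n := n) 1) (R⁻¹ • x))
      (R⁻¹ • x) :=
    ((contDiff_radialField_one.differentiable (by simp)) _).hasFDerivAt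
  have h2 := (h1.comp x ((hasFDerivAt_id x).const_smul R⁻¹)).const_smul R
  have h3 : radialField (n := n) R = fun x => R • (radialField 1 ∘ fun x => R⁻¹ • id x) x := by
    funext x; exact radialField_eq_smul hR x
  rw [h3]
  refine h2.congr_fderiv ?_
  ext v : 1
  simp [smul_smul, hR.ne']

theorem hasFDerivAt_deform {n : ℕ} {R : ℝ} (hR : 0 < R) (t : ℝ) (x : E n) :
    HasFDerivAt (deform R t) (deformDeriv R t x) x :=
  (hasFDerivAt_id x).add ((hasFDerivAt_radialField hR x).const_smul t)

theorem continuous_deformDeriv {n : ℕ} (R t : ℝ) : Continuous (deformDeriv (n := n) R t) := by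
  have := contDiff_radialField_one (n := n).continuous_fderiv (by simp)
  unfold deformDeriv
  fun_prop

theorem contDiff_deform {n : ℕ} {R : ℝ} (hR : 0 < R) (t : ℝ) :
    ContDiff ℝ 1 (deform (n := n) R t) := by
  rw [contDiff_one_iff_fderiv]
  refine ⟨fun x => (hasFDerivAt_deform hR t x).differentiableAt, ?_⟩
  rw [show fderiv ℝ (deform (n := n) R t) = deformDeriv R t from
    funext fun x => (hasFDerivAt_deform hR t x).fderiv]
  exact continuous_deformDeriv R t

theorem exists_norm_fderiv_radialField_le (n : ℕ) :
    ∃ M > 0, ∀ x, ‖fderiv ℝ (radialField (n := n) 1) x‖ ≤ M := by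
  have hc : HasCompactSupport (radialField (n := n) 1) := by
    refine HasCompactSupport.intro (isCompact_closedBall (0 : E n) 2) fun x hx => ?_
    apply radialField_of_le_norm one_pos
    rw [mem_closedBall_zero_iff, not_le] at hx
    linarith
  obtain ⟨M, hM⟩ := (contDiff_radialField_one (n := n).continuous_fderiv (by simp)
    ).bounded_above_of_compact_support (hc.fderiv ℝ)
  exact ⟨max M 1, by positivity, fun x => (hM x).trans (le_max_left _ _)⟩

/-- The quantitative properties of the deformations that hold with a constant independent of the
radius `R`. -/
structure DeformBound (n : ℕ) (c : ℝ) : Prop where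
  one_le : 1 ≤ c
  norm_deriv : ∀ R t (x : E n), ‖deformDeriv R t x - 1‖ ≤ c * |t|
  det : ∀ R t (x : E n), c * |t| ≤ 1 / 2 → |(deformDeriv R t x).det - 1| ≤ c * |t|
  norm_sub : ∀ R, 0 < R → ∀ t (x y : E n),
    ‖deform R t x - deform R t y - (x - y)‖ ≤ c * |t| * ‖x - y‖

theorem exists_deformBound (n : ℕ) : ∃ c, DeformBound n c := by
  obtain ⟨M, hM, hMb⟩ := exists_norm_fderiv_radialField_le n
  obtain ⟨C, hC, δ, hδ, hdet⟩ := exists_abs_det_sub_one_le n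
  have hd : ∀ R t (x : E n), ‖deformDeriv R t x - 1‖ ≤ M * |t| := fun R t x => by
    rw [deformDeriv, add_sub_cancel_left, norm_smul, Real.norm_eq_abs, mul_comm]
    gcongr
    exact hMb _
  refine ⟨1 + M + C * M + M / δ, ⟨?_, fun R t x => (hd R t x).trans ?_, fun R t x ht => ?_,
    fun R hR t x y => ?_⟩⟩
  · have : 0 < M / δ := by positivity
    nlinarith [mul_pos hC hM]
  · gcongr
    have : 0 < M / δ := by positivity
    nlinarith [mul_pos hC hM]
  · have h1 : M / δ * |t| ≤ 1 := by
      have := abs_nonneg t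
      nlinarith [mul_pos hC hM, mul_nonneg (mul_pos hC hM).le this, mul_nonneg hM.le this]
    have h2 : M * |t| ≤ δ := by
      rw [div_mul_eq_mul_div, div_le_one hδ] at h1
      exact h1
    calc _ ≤ C * ‖deformDeriv R t x - 1‖ := hdet _ ((hd R t x).trans h2)
      _ ≤ C * (M * |t|) := by gcongr; exact hd R t x
      _ ≤ _ := by
        have : 0 < M / δ := by positivity
        have := abs_nonneg t
        rw [← mul_assoc]
        gcongr
        linarith
  · have hL : ∀ z ∈ (univ : Set (E n)),
        HasFDerivWithinAt (radialField (n := n) R)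
          (fderiv ℝ (radialField (n := n) 1) (R⁻¹ • z)) univ z :=
      fun z _ => (hasFDerivAt_radialField hR z).hasFDerivWithinAt
    have hk := convex_univ.norm_image_sub_le_of_norm_hasFDerivWithin_le hL
      (fun z _ => hMb _) (mem_univ y) (mem_univ x)
    have e : deform R t x - deform R t y - (x - y) = t • (radialField R x - radialField R y) := by
      simp only [deform, smul_sub]; abel
    rw [e, norm_smul, Real.norm_eq_abs]
    calc |t| * ‖radialField R x - radialField R y‖ ≤ |t| * (M * ‖x - y‖) := by gcongr
      _ = M * |t| * ‖x - y‖ := by ring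
      _ ≤ _ := by
        gcongr
        have : 0 < M / δ := by positivity
        nlinarith [mul_pos hC hM]

namespace DeformBound
variable {n : ℕ} {c R t : ℝ}

theorem det_ge (hc : DeformBound n c) (R : ℝ) (ht : c * |t| ≤ 1 / 2) (x : E n) :
    1 / 2 ≤ (deformDeriv R t x).det := by
  have := (abs_le.1 (hc.det R t x ht)).1
  linarith

theorem bijective (hc : DeformBound n c) (hR : 0 < R) (ht : c * |t| ≤ 1 / 2) :
    Function.Bijective (deform (n := n) R t) := by
  have hct : 0 ≤ c * |t| := mul_nonneg (zero_le_one.trans hc.one_le) (abs_nonneg t)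
  have ha : ApproximatesLinearOn (deform (n := n) R t)
      ((ContinuousLinearEquiv.refl ℝ (E n) : E n ≃L[ℝ] E n) : E n →L[ℝ] E n) univ
      (c * |t|).toNNReal := by
    intro x _ y _
    rw [Real.coe_toNNReal _ hct]
    simpa using! hc.norm_sub R hR t x y
  have hN : Subsingleton (E n) ∨ (c * |t|).toNNReal <
      ‖((ContinuousLinearEquiv.refl ℝ (E n)).symm : E n →L[ℝ] E n)‖₊⁻¹ := by
    rcases subsingleton_or_nontrivial (E n) with h | h
    · exact Or.inl h
    · right
      rw [← NNReal.coe_lt_coe]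
      simp only [Real.coe_toNNReal _ hct, NNReal.coe_inv, coe_nnnorm,
        ContinuousLinearEquiv.refl_symm,
        ContinuousLinearEquiv.coe_refl, ContinuousLinearMap.norm_id, inv_one]
      linarith
  refine ⟨?_, ha.surjective hN⟩
  have := (ha.injOn hN)
  exact injOn_univ.1 this

theorem norm_le (hc : DeformBound n c) (hR : 0 < R) (ht : c * |t| ≤ 1 / 2) (x y : E n) :
    ‖x - y‖ ≤ 2 * ‖deform R t x - deform R t y‖ := by
  have h1 := hc.norm_sub R hR t x y
  have h2 : c * |t| * ‖x - y‖ ≤ 1 / 2 * ‖x - y‖ := by gcongr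
  have h3 := norm_sub_norm_le (x - y) (deform R t x - deform R t y)
  rw [norm_sub_rev (x - y) (_ - _)] at h3
  linarith

theorem deform_zero : deform R t (0 : E n) = 0 := by simp [deform, radialField]

theorem half_le_norm (hc : DeformBound n c) (hR : 0 < R) (ht : c * |t| ≤ 1 / 2) {x : E n}
    (hx : R ≤ ‖x‖) : R / 2 ≤ ‖deform R t x‖ := by
  have := hc.norm_le hR ht x 0
  rw [deform_zero, sub_zero, sub_zero] at this
  linarith

end DeformBound

theorem deform_of_norm_lt {n : ℕ} {R : ℝ} (t : ℝ) {x : E n} (hx : ‖x‖ < R) :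
    deform R t x = (1 + t) • x := by
  have hR : 0 < R := (norm_nonneg x).trans_lt hx
  rw [deform, radialField_of_norm_le hR hx.le, add_smul, one_smul]

theorem deformDeriv_of_norm_lt {n : ℕ} {R : ℝ} (t : ℝ) {x : E n} (hx : ‖x‖ < R) :
    deformDeriv R t x = (1 + t) • (1 : E n →L[ℝ] E n) := by
  have hR : 0 < R := (norm_nonneg x).trans_lt hx
  have h1 := hasFDerivAt_deform hR t x
  have h2 : HasFDerivAt (fun y : E n => (1 + t) • id y) ((1 + t) • (1 : E n →L[ℝ] E n)) x :=
    (hasFDerivAt_id x).const_smul (1 + t)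
  refine h1.unique (h2.congr_of_eventuallyEq ?_)
  filter_upwards [Metric.isOpen_ball.mem_nhds (show x ∈ Metric.ball (0 : E n) R by simpa using hx)]
    with y hy
  exact deform_of_norm_lt t (by simpa using hy)

theorem det_deformDeriv_of_norm_lt {n : ℕ} {R : ℝ} (t : ℝ) {x : E n} (hx : ‖x‖ < R) :
    (deformDeriv R t x).det = (1 + t) ^ n := by
  rw [deformDeriv_of_norm_lt t hx]
  simp [ContinuousLinearMap.det]

theorem deform_of_le_norm {n : ℕ} {R : ℝ} (hR : 0 < R) (t : ℝ) {x : E n} (hx : 2 * R ≤ ‖x‖) :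
    deform R t x = x := by
  rw [deform, radialField_of_le_norm hR hx, smul_zero, add_zero]

theorem continuous_deform {n : ℕ} {R : ℝ} (hR : 0 < R) (t : ℝ) :
    Continuous (deform (n := n) R t) := (contDiff_deform hR t).continuous

/-! ### Change of variables -/

/-- `Φ` is a change of variables on `(Y, μ)` with Jacobian `J`, bounded from below. -/
structure IsChangeOfVariables {Y : Type*} [MeasurableSpace Y] (μ : Measure Y) (Φ : Y → Y)
    (J : Y → ℝ) : Prop where
  measurable_jacobian : Measurable J
  le_jacobian : ∀ x, 1 / 4 ≤ J x
  measurePreserving : MeasurePreserving Φ (μ.withDensity fun x => ENNReal.ofReal (J x)) μ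

namespace IsChangeOfVariables

variable {Y : Type*} [MeasurableSpace Y] {μ : Measure Y} {Φ : Y → Y} {J : Y → ℝ}
variable {F : Type*} [NormedAddCommGroup F]

/-- The lower bound on the Jacobian compares `μ` with the measure that `Φ` pushes forward to `μ`,
so that composition with `Φ` is bounded on every `L^p`. -/
theorem le_smul (h : IsChangeOfVariables μ Φ J) :
    μ ≤ (4 : ENNReal) • μ.withDensity fun x => ENNReal.ofReal (J x) := by
  rw [← withDensity_smul _ h.measurable_jacobian.ennreal_ofReal]
  conv_lhs => rw [← withDensity_one (μ := μ)]
  apply withDensity_mono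
  refine Eventually.of_forall fun x => ?_
  simp only [Pi.one_apply, Pi.smul_apply, smul_eq_mul]
  rw [show (4 : ENNReal) = ENNReal.ofReal 4 by simp, ← ENNReal.ofReal_mul (by norm_num),
    ← ENNReal.ofReal_one]
  apply ENNReal.ofReal_le_ofReal
  have := h.le_jacobian x
  linarith

theorem quasiMeasurePreserving (h : IsChangeOfVariables μ Φ J) :
    Measure.QuasiMeasurePreserving Φ μ μ :=
  ⟨h.measurePreserving.measurable, by
    have h1 : μ ≪ μ.withDensity fun x => ENNReal.ofReal (J x) :=
      Measure.absolutelyContinuous_of_le_smul h.le_smul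
    have := h1.map h.measurePreserving.measurable
    rwa [h.measurePreserving.map_eq] at this⟩

theorem eLpNorm_comp_le (h : IsChangeOfVariables μ Φ J) {p : ℝ} (hp : 1 ≤ p) {g : Y → F}
    (hg : AEStronglyMeasurable g μ) :
    eLpNorm (fun x => g (Φ x)) (ENNReal.ofReal p) μ ≤ 4 * eLpNorm g (ENNReal.ofReal p) μ := by
  calc eLpNorm (fun x => g (Φ x)) (ENNReal.ofReal p) μ
      ≤ eLpNorm (fun x => g (Φ x)) (ENNReal.ofReal p)
        ((4 : ENNReal) • μ.withDensity fun x => ENNReal.ofReal (J x)) :=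
        eLpNorm_mono_measure _ h.le_smul
    _ = (4 : ENNReal) ^ (1 / p) * eLpNorm (fun x => g (Φ x)) (ENNReal.ofReal p)
        (μ.withDensity fun x => ENNReal.ofReal (J x)) := by
        rw [eLpNorm_smul_measure_of_ne_top ENNReal.ofReal_ne_top, smul_eq_mul]
        simp [ENNReal.toReal_ofReal (zero_le_one.trans hp)]
    _ = (4 : ENNReal) ^ (1 / p) * eLpNorm g (ENNReal.ofReal p) μ := by
        rw [← eLpNorm_comp_measurePreserving hg h.measurePreserving]; rfl
    _ ≤ _ := by
        gcongr
        calc (4 : ENNReal) ^ (1 / p) ≤ 4 ^ (1 : ℝ) :=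
              ENNReal.rpow_le_rpow_of_exponent_le (by norm_num)
                (by rw [div_le_one (by linarith)]; exact hp)
          _ = 4 := ENNReal.rpow_one _

theorem memLp_comp (h : IsChangeOfVariables μ Φ J) {p : ℝ} (hp : 1 ≤ p) {g : Y → F}
    (hg : MemLp g (ENNReal.ofReal p) μ) : MemLp (fun x => g (Φ x)) (ENNReal.ofReal p) μ :=
  ⟨hg.1.comp_quasiMeasurePreserving h.quasiMeasurePreserving,
    (h.eLpNorm_comp_le hp hg.1).trans_lt (ENNReal.mul_lt_top (by simp) hg.2)⟩

theorem integrable_comp (h : IsChangeOfVariables μ Φ J) {g : Y → F} (hg : Integrable g μ) :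
    Integrable (fun x => g (Φ x)) μ := by
  rw [← memLp_one_iff_integrable, ← ENNReal.ofReal_one] at hg ⊢
  exact h.memLp_comp le_rfl hg

theorem integrable_comp_mul (h : IsChangeOfVariables μ Φ J) {g : Y → ℝ} (hg : Integrable g μ) :
    Integrable (fun x => g (Φ x) * J x) μ := by
  have h1 := h.measurePreserving.integrable_comp_of_integrable hg
  rw [integrable_withDensity_iff_integrable_smul' h.measurable_jacobian.ennreal_ofReal
    (Eventually.of_forall fun _ => ENNReal.ofReal_lt_top)] at h1
  refine h1.congr (Eventually.of_forall fun x => ?_)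
  have := h.le_jacobian x
  simp only [smul_eq_mul, Function.comp_apply]
  rw [ENNReal.toReal_ofReal (by linarith), mul_comm]

theorem integral_comp_mul (h : IsChangeOfVariables μ Φ J) {g : Y → ℝ}
    (hg : AEStronglyMeasurable g μ) : ∫ x, g (Φ x) * J x ∂μ = ∫ x, g x ∂μ := by
  have h1 : ∫ x, g x ∂μ = ∫ x, g (Φ x) ∂(μ.withDensity fun x => ENNReal.ofReal (J x)) := by
    conv_lhs => rw [← h.measurePreserving.map_eq]
    rw [integral_map h.measurePreserving.measurable.aemeasurable]
    rwa [h.measurePreserving.map_eq]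
  rw [h1, integral_withDensity_eq_integral_toReal_smul h.measurable_jacobian.ennreal_ofReal
    (Eventually.of_forall fun _ => ENNReal.ofReal_lt_top)]
  refine integral_congr_ae (Eventually.of_forall fun x => ?_)
  have := h.le_jacobian x
  simp only [smul_eq_mul]
  rw [ENNReal.toReal_ofReal (by linarith), mul_comm]

theorem integral_comp_le (h : IsChangeOfVariables μ Φ J) {g : Y → ℝ} (hg : Integrable g μ)
    (hg0 : ∀ x, 0 ≤ g x) : ∫ x, g (Φ x) ∂μ ≤ 4 * ∫ x, g x ∂μ := by
  rw [← h.integral_comp_mul hg.1, ← integral_const_mul]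
  refine integral_mono (h.integrable_comp hg) ((h.integrable_comp_mul hg).const_mul 4) fun x => ?_
  have := h.le_jacobian x
  have := hg0 (Φ x)
  change g (Φ x) ≤ 4 * (g (Φ x) * J x)
  nlinarith

/-- If `W` is close to `k` times the pull-back of the density `N`, with an error that is small
relative to `N` off the pull-back of `T` and merely bounded relative to `N` on it, then `∫ W` is
close to `k ∫ N`. -/
theorem abs_integral_sub_le (h : IsChangeOfVariables μ Φ J) {N W : Y → ℝ} (hN : Integrable N μ)
    (hW : AEStronglyMeasurable W μ) {T : Set Y} (hT : MeasurableSet T) {k ε C : ℝ}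
    (hb : ∀ x, |W x - k * (N (Φ x) * J x)| ≤
      ε * |N (Φ x)| + C * T.indicator (fun y => |N y|) (Φ x)) (hε : 0 ≤ ε) (hC : 0 ≤ C) :
    Integrable W μ ∧ |∫ x, W x ∂μ - k * ∫ x, N x ∂μ| ≤
      4 * ε * ∫ x, |N x| ∂μ + 4 * C * ∫ x in T, |N x| ∂μ := by
  have hNT : Integrable (T.indicator fun y => |N y|) μ := hN.abs.indicator hT
  have hdom : Integrable (fun x => ε * |N (Φ x)| + C * T.indicator (fun y => |N y|) (Φ x)) μ :=
    ((h.integrable_comp hN.abs).const_mul ε).add ((h.integrable_comp hNT).const_mul C)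
  have hk : Integrable (fun x => k * (N (Φ x) * J x)) μ := (h.integrable_comp_mul hN).const_mul k
  have hd : Integrable (fun x => W x - k * (N (Φ x) * J x)) μ :=
    hdom.mono' (hW.sub hk.1) (Eventually.of_forall hb)
  have hWi : Integrable W μ := by
    refine (hd.add hk).congr (Eventually.of_forall fun x => ?_)
    simp
  refine ⟨hWi, ?_⟩
  have e : ∫ x, W x ∂μ - k * ∫ x, N x ∂μ = ∫ x, (W x - k * (N (Φ x) * J x)) ∂μ := by
    rw [integral_sub hWi hk, integral_const_mul, h.integral_comp_mul hN.1]
  rw [e]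
  calc |∫ x, (W x - k * (N (Φ x) * J x)) ∂μ|
      ≤ ∫ x, |W x - k * (N (Φ x) * J x)| ∂μ := abs_integral_le_integral_abs
    _ ≤ ∫ x, (ε * |N (Φ x)| + C * T.indicator (fun y => |N y|) (Φ x)) ∂μ :=
        integral_mono hd.abs hdom hb
    _ = ε * ∫ x, |N (Φ x)| ∂μ + C * ∫ x, T.indicator (fun y => |N y|) (Φ x) ∂μ := by
        rw [integral_add ((h.integrable_comp hN.abs).const_mul ε)
          ((h.integrable_comp hNT).const_mul C), integral_const_mul, integral_const_mul]
    _ ≤ ε * (4 * ∫ x, |N x| ∂μ) + C * (4 * ∫ x in T, |N x| ∂μ) := by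
        gcongr
        · exact h.integral_comp_le hN.abs fun _ => abs_nonneg _
        · rw [← integral_indicator hT]
          exact h.integral_comp_le hNT fun x => indicator_nonneg (fun _ _ => abs_nonneg _) x
    _ = _ := by ring

end IsChangeOfVariables

theorem DeformBound.isChangeOfVariables {n : ℕ} {c R t : ℝ} (hc : DeformBound n c) (hR : 0 < R)
    (ht : c * |t| ≤ 1 / 2) : IsChangeOfVariables (volume : Measure (E n)) (deform R t)
      (fun x => (deformDeriv R t x).det) := by
  have hJ : Continuous (fun x : E n => (deformDeriv R t x).det) :=
    differentiable_det.continuous.comp (continuous_deformDeriv R t)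
  refine ⟨hJ.measurable, fun x => by linarith [hc.det_ge R ht x],
    (continuous_deform hR t).measurable, ?_⟩
  have h := map_withDensity_abs_det_fderiv_eq_addHaar (volume : Measure (E n))
    (s := univ) (f := deform R t) (f' := deformDeriv R t) nullMeasurableSet_univ
    (fun x _ => (hasFDerivAt_deform hR t x).hasFDerivWithinAt) (hc.bijective hR ht).1.injOn
  rw [Measure.restrict_univ, image_univ, (hc.bijective hR ht).2.range_eq,
    Measure.restrict_univ] at h
  rw [← h]
  congr 2
  funext x
  rw [abs_of_nonneg (by linarith [hc.det_ge R ht x])]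

theorem DeformBound.isChangeOfVariables_prod {n : ℕ} {c R t : ℝ} (hc : DeformBound n c)
    (hR : 0 < R) (ht : c * |t| ≤ 1 / 2) :
    IsChangeOfVariables (volume : Measure (E n × E n)) (Prod.map (deform R t) (deform R t))
      (fun z => (deformDeriv R t z.1).det * (deformDeriv R t z.2).det) := by
  have h := hc.isChangeOfVariables hR ht
  refine ⟨(h.measurable_jacobian.comp measurable_fst).mul
    (h.measurable_jacobian.comp measurable_snd), fun z => ?_, ?_⟩
  · have h1 := hc.det_ge R ht z.1
    have h2 := hc.det_ge R ht z.2
    nlinarith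
  · have hm := h.measurePreserving.prod h.measurePreserving
    rw [prod_withDensity h.measurable_jacobian.ennreal_ofReal
      h.measurable_jacobian.ennreal_ofReal] at hm
    have e : (fun z : E n × E n =>
        ENNReal.ofReal ((deformDeriv R t z.1).det * (deformDeriv R t z.2).det)) =
        fun z => ENNReal.ofReal (deformDeriv R t z.1).det *
          ENNReal.ofReal (deformDeriv R t z.2).det := by
      funext z
      rw [ENNReal.ofReal_mul]
      linarith [hc.det_ge R ht z.1]
    rw [e]
    exact hm

/-! ### Densities under maps that are dilations on a large ball -/

/-- The weights `ρ ^ a` and Jacobians `J` of a map at distance `O(|t|)` from the identity differ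
from `1` by `O(|t|)`; this serves where the map is no dilation. -/
theorem exists_abs_rpow_sub_mul_le (a b c : ℝ) : ∃ C > 0, ∃ δ > 0, ∀ t ρ J : ℝ,
    |t| ≤ δ → |ρ - 1| ≤ c * |t| → |J - 1| ≤ c * |t| →
      |ρ ^ a - (1 + t * b) * J| ≤ C * |t| := by
  have h : HasDerivAt (fun r : ℝ => r ^ a) (a * 1 ^ (a - 1)) 1 :=
    Real.hasDerivAt_rpow_const (Or.inl one_ne_zero)
  obtain ⟨C, hC, hb⟩ := h.hasFDerivAt.isBigO_sub.exists_pos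
  obtain ⟨δ, hδ, hb⟩ := Metric.eventually_nhds_iff_ball.1 hb.bound
  have hc' : 0 < |c| + 1 := by positivity
  refine ⟨(C + 1) * (|c| + 1) + |b| * (|c| + 2), by positivity, min 1 (δ / 2 / (|c| + 1)),
    by positivity, fun t ρ J ht hρ hJ => ?_⟩
  have ht1 : |t| ≤ 1 := ht.trans (min_le_left _ _)
  have ht0 := abs_nonneg t
  have hct : c * |t| ≤ (|c| + 1) * |t| := by
    gcongr
    linarith [le_abs_self c]
  have hρδ : |ρ - 1| < δ := by
    have := ht.trans (min_le_right _ _)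
    rw [le_div_iff₀ hc'] at this
    linarith
  have h1 : |ρ ^ a - 1| ≤ C * ((|c| + 1) * |t|) := by
    have := hb ρ (by rwa [Metric.mem_ball, Real.dist_eq])
    simp only [Real.one_rpow, Real.norm_eq_abs] at this
    refine this.trans ?_
    gcongr
    exact hρ.trans hct
  have hJ' := hJ.trans hct
  have hJ2 : |J| ≤ |c| + 2 := by
    have := abs_add_le (J - 1) 1
    rw [sub_add_cancel, abs_one] at this
    nlinarith
  have e : ρ ^ a - (1 + t * b) * J = (ρ ^ a - 1) - (J - 1) - t * b * J := by ring
  rw [e]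
  calc _ ≤ |ρ ^ a - 1| + |J - 1| + |t * b * J| :=
        (abs_sub _ _).trans (by gcongr; exact abs_sub _ _)
    _ ≤ C * ((|c| + 1) * |t|) + (|c| + 1) * |t| + |t| * |b| * (|c| + 2) := by
        rw [abs_mul, abs_mul]
        gcongr
    _ = _ := by ring

/-- For the dilation by `1 + t` the weight `(1 + t) ^ a` and the Jacobian `(1 + t) ^ m` combine to
`1 + t (a - m)` up to `o(t)`. -/
theorem exists_abs_one_add_rpow_sub_le (a : ℝ) (m : ℕ) {ε : ℝ} (hε : 0 < ε) :
    ∃ δ > 0, ∀ t : ℝ, |t| ≤ δ → |(1 + t) ^ a - (1 + t * (a - m)) * (1 + t) ^ m| ≤ ε * |t| := by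
  have h1 : HasDerivAt (fun t : ℝ => 1 + t) 1 0 := (hasDerivAt_id (0 : ℝ)).const_add 1
  have h2 : HasDerivAt (fun t : ℝ => (1 + t) ^ a) (1 * a * (1 + 0) ^ (a - 1)) 0 :=
    h1.rpow_const (Or.inl (by norm_num))
  have h3 : HasDerivAt (fun t : ℝ => (1 + t) ^ m) _ 0 := h1.pow m
  have h4 : HasDerivAt (fun t : ℝ => 1 + t * (a - m)) (1 * (a - m)) 0 :=
    ((hasDerivAt_id (0 : ℝ)).mul_const _).const_add 1
  have h5 : HasDerivAt (fun t : ℝ => (1 + t) ^ a - (1 + t * (a - m)) * (1 + t) ^ m) 0 0 := by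
    refine (h2.sub (h4.mul h3)).congr_deriv ?_
    simp
  have h6 := (hasDerivAt_iff_isLittleO.1 h5).bound hε
  obtain ⟨δ, hδ, hb⟩ := Metric.eventually_nhds_iff_ball.1 h6
  refine ⟨δ / 2, by positivity, fun t ht => ?_⟩
  have := hb t (by rw [Metric.mem_ball, dist_zero_right, Real.norm_eq_abs]; linarith)
  simpa using this

theorem exists_integral_tail_le {Y : Type*} [NormedAddCommGroup Y] [MeasurableSpace Y]
    [BorelSpace Y] {μ : Measure Y} {N : Y → ℝ} (hN : Integrable N μ) {ε : ℝ} (hε : 0 < ε) :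
    ∃ R₀ > 0, ∀ R ≥ R₀, ∫ y in {y | R / 2 ≤ ‖y‖}, |N y| ∂μ ≤ ε := by
  have hm : ∀ r : ℝ, MeasurableSet {y : Y | r ≤ ‖y‖} := fun r =>
    measurableSet_le measurable_const measurable_norm
  have h := tendsto_setIntegral_of_antitone (μ := μ) (f := fun y => |N y|)
    (s := fun k : ℕ => {y : Y | (k : ℝ) ≤ ‖y‖}) (fun k => hm k)
    (fun i j hij y (hy : (j : ℝ) ≤ ‖y‖) => (Nat.cast_le.2 hij).trans hy)
    ⟨0, hN.abs.integrableOn⟩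
  have he : ⋂ k : ℕ, {y : Y | (k : ℝ) ≤ ‖y‖} = ∅ := by
    ext y
    simp only [mem_iInter, mem_ofPred_eq, mem_empty_iff_false, iff_false, not_forall, not_le]
    exact exists_nat_gt ‖y‖
  rw [he, setIntegral_empty] at h
  obtain ⟨K, hK⟩ := (h.eventually_le_const hε).exists
  refine ⟨2 * (K + 1), by positivity, fun R hR => le_trans ?_ hK⟩
  refine setIntegral_mono_set hN.abs.integrableOn
    (Eventually.of_forall fun _ => abs_nonneg _) (Eventually.of_forall fun y hy => ?_)
  have hy' : R / 2 ≤ ‖y‖ := hy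
  change (K : ℝ) ≤ ‖y‖
  linarith

/-- The common mechanism behind the variation of all three integrals. If `W` is obtained from the
density `N` by a change of variables close to the identity, with weight `ρ ^ a`, and if on a large
ball `ρ` and the Jacobian are those of a dilation by `1 + t`, then `∫ W` is `1 + t (a - m)` times
`∫ N`, up to an error `ε |t|`. -/
theorem exists_abs_integral_sub_le_of_dilation_on_ball {Y : Type*} [NormedAddCommGroup Y]
    [MeasurableSpace Y] [BorelSpace Y] {μ : Measure Y} {N : Y → ℝ} (hN : Integrable N μ)
    (a : ℝ) (m : ℕ) (c : ℝ) {ε : ℝ} (hε : 0 < ε) :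
    ∃ R₀ > 0, ∃ δ > 0, ∀ R ≥ R₀, ∀ t, |t| ≤ δ → ∀ (Φ : Y → Y) (J W : Y → ℝ),
      IsChangeOfVariables μ Φ J → AEStronglyMeasurable W μ →
      (∀ x, R ≤ ‖x‖ → R / 2 ≤ ‖Φ x‖) →
      (∀ x, ∃ ρ, W x = ρ ^ a * N (Φ x) ∧ |ρ - 1| ≤ c * |t| ∧ |J x - 1| ≤ c * |t| ∧
        (‖x‖ < R → ρ = 1 + t ∧ J x = (1 + t) ^ m)) →
      Integrable W μ ∧ |∫ x, W x ∂μ - (1 + t * (a - m)) * ∫ x, N x ∂μ| ≤ ε * |t| := by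
  obtain ⟨C, hC, δ₁, hδ₁, h1⟩ := exists_abs_rpow_sub_mul_le a (a - m) c
  set I := ∫ x, |N x| ∂μ with hI
  have hI0 : 0 ≤ I := integral_nonneg fun _ => abs_nonneg _
  have hε₁ : 0 < ε / (8 * (I + 1)) := by positivity
  obtain ⟨δ₂, hδ₂, h2⟩ := exists_abs_one_add_rpow_sub_le a m hε₁
  obtain ⟨R₀, hR₀, hR⟩ := exists_integral_tail_le hN (show 0 < ε / (8 * C) by positivity)
  refine ⟨R₀, hR₀, min δ₁ δ₂, by positivity, fun R hRR t ht Φ J W hΦ hW hout hpt => ?_⟩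
  have hT : MeasurableSet {y : Y | R / 2 ≤ ‖y‖} :=
    measurableSet_le measurable_const measurable_norm
  have ht0 := abs_nonneg t
  obtain ⟨hWi, hle⟩ := hΦ.abs_integral_sub_le hN hW hT (k := 1 + t * (a - m))
    (ε := ε / (8 * (I + 1)) * |t|) (C := C * |t|) (fun x => by
      obtain ⟨ρ, hρ, hρ1, hJ1, hin⟩ := hpt x
      have e : W x - (1 + t * (a - m)) * (N (Φ x) * J x) =
          (ρ ^ a - (1 + t * (a - m)) * J x) * N (Φ x) := by rw [hρ]; ring
      rw [e, abs_mul]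
      rcases lt_or_ge ‖x‖ R with hx | hx
      · obtain ⟨hρ2, hJ2⟩ := hin hx
        have h0 : 0 ≤ C * |t| * {y : Y | R / 2 ≤ ‖y‖}.indicator (fun y => |N y|) (Φ x) :=
          mul_nonneg (by positivity) (indicator_nonneg (fun _ _ => abs_nonneg _) _)
        refine le_add_of_le_of_nonneg ?_ h0
        gcongr
        rw [hρ2, hJ2]
        exact h2 t (ht.trans (min_le_right _ _))
      · have hmem : Φ x ∈ {y : Y | R / 2 ≤ ‖y‖} := hout x hx
        rw [indicator_of_mem hmem]
        refine le_add_of_nonneg_of_le (by positivity) ?_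
        gcongr
        exact h1 t ρ (J x) (ht.trans (min_le_left _ _)) hρ1 hJ1)
    (by positivity) (by positivity)
  refine ⟨hWi, hle.trans ?_⟩
  have e1 : 4 * (ε / (8 * (I + 1)) * |t|) * I ≤ ε / 2 * |t| := by
    have : ε / (8 * (I + 1)) * I ≤ ε / 8 := by
      rw [div_mul_eq_mul_div, div_le_div_iff₀ (by positivity) (by norm_num)]
      nlinarith
    nlinarith
  have e2 : 4 * (C * |t|) * ∫ x in {y | R / 2 ≤ ‖y‖}, |N x| ∂μ ≤ ε / 2 * |t| := by
    calc _ ≤ 4 * (C * |t|) * (ε / (8 * C)) := by gcongr; exact hR R hRR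
      _ = _ := by field_simp; ring
  linarith

/-! ### Finsler norms and convexity of the energy densities -/

theorem measurable_gradient {n : ℕ} (H : E n → ℝ) : Measurable (gradient H) :=
  (InnerProductSpace.toDual ℝ (E n)).symm.continuous.measurable.comp (measurable_fderiv ℝ H)

namespace IsFinslerMinkowskiNorm

variable {n : ℕ} {H : E n → ℝ}

theorem map_add_le (hH : IsFinslerMinkowskiNorm H) (a b : E n) : H (a + b) ≤ H a + H b := by
  have h := hH.convex.2 (mem_univ a) (mem_univ b) (show (0 : ℝ) ≤ 1 / 2 by norm_num)
    (show (0 : ℝ) ≤ 1 / 2 by norm_num) (by norm_num)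
  rw [← smul_add, hH.homogeneous, abs_of_nonneg (by norm_num)] at h
  simp only [smul_eq_mul] at h
  linarith

theorem abs_sub_le (hH : IsFinslerMinkowskiNorm H) (a b : E n) : |H a - H b| ≤ H (a - b) := by
  have h1 := hH.map_add_le (a - b) b
  have h2 := hH.map_add_le (b - a) a
  have h3 := hH.homogeneous (-1) (a - b)
  simp only [neg_smul, one_smul, neg_sub, abs_neg, abs_one, one_mul] at h3
  simp only [sub_add_cancel] at h1 h2
  rw [abs_le]
  constructor <;> linarith

theorem exists_lipschitz (hH : IsFinslerMinkowskiNorm H) : ∃ K, LipschitzWith K H := by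
  obtain ⟨C₁, C₂, -, h2, hb⟩ := hH.bounds
  refine ⟨C₂.toNNReal, LipschitzWith.of_dist_le_mul fun a b => ?_⟩
  rw [Real.dist_eq, dist_eq_norm, Real.coe_toNNReal _ h2.le]
  exact (hH.abs_sub_le a b).trans (hb _).2

theorem continuous (hH : IsFinslerMinkowskiNorm H) : Continuous H :=
  hH.exists_lipschitz.choose_spec.continuous

theorem differentiableAt (hH : IsFinslerMinkowskiNorm H) {ξ : E n} (hξ : ξ ≠ 0) :
    DifferentiableAt ℝ H ξ :=
  (hH.contDiffOn.contDiffAt (isOpen_compl_singleton.mem_nhds hξ)).differentiableAt one_ne_zero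

theorem inner_gradient_le (hH : IsFinslerMinkowskiNorm H) {ξ : E n} (hξ : ξ ≠ 0) (η : E n) :
    ⟪gradient H ξ, η - ξ⟫ ≤ H η - H ξ := by
  have hc : ConvexOn ℝ univ (H ∘ AffineMap.lineMap (k := ℝ) ξ η) := by
    simpa using hH.convex.comp_affineMap (AffineMap.lineMap (k := ℝ) ξ η)
  have hd : HasDerivAt (H ∘ AffineMap.lineMap (k := ℝ) ξ η) (fderiv ℝ H ξ (η - ξ)) 0 := by
    have h1 : HasFDerivAt H (fderiv ℝ H ξ) (AffineMap.lineMap (k := ℝ) ξ η (0 : ℝ)) := by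
      rw [AffineMap.lineMap_apply_zero]
      exact (hH.differentiableAt hξ).hasFDerivAt
    exact h1.comp_hasDerivAt 0 AffineMap.hasDerivAt_lineMap
  have := hc.le_slope_of_hasDerivAt (mem_univ 0) (mem_univ 1) one_pos hd
  rw [inner_gradient_left]
  simpa [slope_def_field] using this

theorem exists_norm_gradient_le (hH : IsFinslerMinkowskiNorm H) :
    ∃ K, 0 ≤ K ∧ ∀ ξ, ‖gradient H ξ‖ ≤ K := by
  obtain ⟨K, hK⟩ := hH.exists_lipschitz
  refine ⟨K, K.2, fun ξ => ?_⟩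
  rw [gradient, LinearIsometryEquiv.norm_map]
  exact norm_fderiv_le_of_lipschitz ℝ hK

end IsFinslerMinkowskiNorm

/-- Bernoulli's inequality, as the supporting-line inequality for `x ^ p` on `[0, ∞)`. -/
theorem mul_rpow_sub_one_mul_sub_le {p : ℝ} (hp : 1 < p) {a b : ℝ} (ha : 0 ≤ a) (hb : 0 ≤ b) :
    p * a ^ (p - 1) * (b - a) ≤ b ^ p - a ^ p := by
  rcases ha.eq_or_lt with rfl | ha
  · rw [Real.zero_rpow (by linarith), Real.zero_rpow (by linarith)]
    simpa using Real.rpow_nonneg hb p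
  · have h := one_add_mul_self_le_rpow_one_add (s := b / a - 1) (by
      have : 0 ≤ b / a := by positivity
      linarith) hp.le
    rw [add_sub_cancel, Real.div_rpow hb ha.le, le_div_iff₀ (by positivity)] at h
    have e : a ^ p = a ^ (p - 1) * a := by
      rw [← Real.rpow_add_one ha.ne', sub_add_cancel]
    have e2 : (1 + p * (b / a - 1)) * a ^ p = a ^ p + p * a ^ (p - 1) * (b - a) := by
      rw [e]; field_simp
    linarith

/-- The supporting-hyperplane inequality for the convex function `H ^ p`, whose gradient is
`p H ^ (p - 1) ∇H`. -/
theorem IsFinslerMinkowskiNorm.rpow_convexity {n : ℕ} {H : E n → ℝ}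
    (hH : IsFinslerMinkowskiNorm H) {p : ℝ} (hp : 1 < p) (ξ η : E n) :
    p * (H ξ ^ (p - 1) * ⟪gradient H ξ, η - ξ⟫) ≤ H η ^ p - H ξ ^ p := by
  rcases eq_or_ne ξ 0 with rfl | hξ
  -- `H` is not differentiable at `0`, but the factor `H 0 ^ (p - 1)` vanishes there
  · rw [(hH.eq_zero_iff 0).2 rfl, Real.zero_rpow (by linarith), Real.zero_rpow (by linarith)]
    simpa using Real.rpow_nonneg (hH.nonneg η) p
  · refine le_trans ?_ (mul_rpow_sub_one_mul_sub_le hp (hH.nonneg ξ) (hH.nonneg η))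
    rw [← mul_assoc]
    have := Real.rpow_nonneg (hH.nonneg ξ) (p - 1)
    gcongr
    exact hH.inner_gradient_le hξ η

theorem abs_J {p : ℝ} (hp : 1 < p) (r : ℝ) : |J p r| = |r| ^ (p - 1) := by
  rcases eq_or_ne r 0 with rfl | hr
  · simp [J, Real.zero_rpow (show p - 1 ≠ 0 by linarith)]
  · rw [J, abs_mul, abs_of_nonneg (Real.rpow_nonneg (abs_nonneg r) _),
      ← Real.rpow_add_one (abs_ne_zero.2 hr)]
    congr 1; ring

/-- The supporting-hyperplane inequality for the convex function `|·| ^ p`. -/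
theorem J_convexity {p : ℝ} (hp : 1 < p) (a b : ℝ) :
    p * (J p a * (b - a)) ≤ |b| ^ p - |a| ^ p := by
  refine le_trans ?_ (mul_rpow_sub_one_mul_sub_le hp (abs_nonneg a) (abs_nonneg b))
  rw [mul_assoc]
  gcongr p * ?_
  rcases eq_or_ne a 0 with rfl | ha
  · simp [J, Real.zero_rpow (show p - 1 ≠ 0 by linarith)]
  · have e : |a| ^ (p - 1) = |a| ^ (p - 2) * |a| := by
      rw [← Real.rpow_add_one (abs_ne_zero.2 ha)]; congr 1; ring
    rw [e, J, mul_assoc, mul_assoc]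
    gcongr ?_ * ?_
    have h1 : a * b ≤ |a| * |b| := by rw [← abs_mul]; exact le_abs_self _
    have h2 : |a| * |a| = a * a := abs_mul_abs_self a
    linarith

theorem J_mul {p : ℝ} {k : ℝ} (hk : 0 < k) (r : ℝ) : J p (k * r) = k ^ (p - 1) * J p r := by
  rw [J, J, abs_mul, abs_of_pos hk, Real.mul_rpow hk.le (abs_nonneg r)]
  have : k ^ (p - 1) = k ^ (p - 2) * k := by
    rw [← Real.rpow_add_one hk.ne']; congr 1; ring
  rw [this]; ring

/-! ### Variation of the integrals along truncated dilations -/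

/-- The gradient of `u ∘ deform R t`, where `G` is the gradient of `u`. -/
def pullbackGrad {n : ℕ} (R t : ℝ) (G : E n → E n) (x : E n) : E n :=
  (deformDeriv R t x).adjoint (G (deform R t x))

/-- The weighted difference quotient `(u(x) - u(y)) / |x - y|^κ`, as a function on `ℝⁿ × ℝⁿ`. -/
def diffQuot {n : ℕ} (κ : ℝ) (u : E n → ℝ) (z : E n × E n) : ℝ :=
  (u z.1 - u z.2) / ‖z.1 - z.2‖ ^ κ

theorem aestronglyMeasurable_pullbackGrad {n : ℕ} {c R t : ℝ} (hc : DeformBound n c) (hR : 0 < R)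
    (ht : c * |t| ≤ 1 / 2) {G : E n → E n} (hG : AEStronglyMeasurable G) :
    AEStronglyMeasurable (pullbackGrad R t G) := by
  have h1 : AEStronglyMeasurable (fun x => G (deform R t x)) :=
    hG.comp_quasiMeasurePreserving (hc.isChangeOfVariables hR ht).quasiMeasurePreserving
  have h2 : Continuous (fun x : E n => (deformDeriv R t x).adjoint) :=
    ContinuousLinearMap.adjoint.continuous.comp (continuous_deformDeriv R t)
  exact (isBoundedBilinearMap_apply (𝕜 := ℝ) (E := E n) (F := E n)).continuous
    |>.comp_aestronglyMeasurable (h2.aestronglyMeasurable.prodMk h1)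

theorem norm_adjoint_deformDeriv_sub_le {n : ℕ} {c : ℝ} (hc : DeformBound n c) (R t : ℝ)
    (x ξ : E n) : ‖(deformDeriv R t x).adjoint ξ - ξ‖ ≤ c * |t| * ‖ξ‖ := by
  have e : (deformDeriv R t x).adjoint ξ - ξ = (deformDeriv R t x - 1).adjoint ξ := by
    rw [map_sub, sub_apply]
    congr 1
    exact (congrArg (fun A : E n →L[ℝ] E n => A ξ) (star_one (E n →L[ℝ] E n))).symm
  rw [e]
  refine (ContinuousLinearMap.le_opNorm _ _).trans ?_
  rw [LinearIsometryEquiv.norm_map]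
  gcongr
  exact hc.norm_deriv R t x

theorem norm_pullbackGrad_le {n : ℕ} {c R t : ℝ} (hc : DeformBound n c)
    (ht : c * |t| ≤ 1 / 2) (G : E n → E n) (x : E n) :
    ‖pullbackGrad R t G x‖ ≤ 2 * ‖G (deform R t x)‖ := by
  have h1 := norm_adjoint_deformDeriv_sub_le hc R t x (G (deform R t x))
  have h2 := norm_sub_norm_le (pullbackGrad R t G x) (G (deform R t x))
  have h3 : c * |t| * ‖G (deform R t x)‖ ≤ 1 / 2 * ‖G (deform R t x)‖ := by gcongr
  have h4 := norm_nonneg (G (deform R t x))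
  rw [pullbackGrad] at h2 ⊢
  linarith

theorem memLp_pullbackGrad {n : ℕ} {c R t p : ℝ} (hc : DeformBound n c) (hR : 0 < R)
    (ht : c * |t| ≤ 1 / 2) (hp : 1 ≤ p) {G : E n → E n} (hG : MemLp G (ENNReal.ofReal p)) :
    MemLp (pullbackGrad R t G) (ENNReal.ofReal p) :=
  ((hc.isChangeOfVariables hR ht).memLp_comp hp hG).of_le_mul
    (aestronglyMeasurable_pullbackGrad hc hR ht hG.1)
    (Eventually.of_forall fun x => norm_pullbackGrad_le hc ht G x)

theorem IsFinslerMinkowskiNorm.integrable_rpow {n : ℕ} {H : E n → ℝ}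
    (hH : IsFinslerMinkowskiNorm H) {p : ℝ} (hp : 1 < p) {G : E n → E n}
    (hG : MemLp G (ENNReal.ofReal p)) : Integrable (fun x => H (G x) ^ p) := by
  obtain ⟨C₁, C₂, -, h2, hb⟩ := hH.bounds
  have hi := hG.integrable_norm_rpow (by simp; linarith) ENNReal.ofReal_ne_top
  rw [ENNReal.toReal_ofReal (by linarith)] at hi
  refine (hi.const_mul (C₂ ^ p)).mono' ?_ (Eventually.of_forall fun x => ?_)
  · exact ((Real.continuous_rpow_const (by linarith)).comp
      hH.continuous).comp_aestronglyMeasurable hG.1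
  · rw [Real.norm_of_nonneg (Real.rpow_nonneg (hH.nonneg _) _),
      ← Real.mul_rpow h2.le (norm_nonneg _)]
    exact Real.rpow_le_rpow (hH.nonneg _) (hb _).2 (by linarith)

/-- Variation of the anisotropic energy along the truncated dilations. -/
theorem exists_abs_integral_finsler_pullback_sub_le {n : ℕ} {c : ℝ} (hc : DeformBound n c)
    {H : E n → ℝ} (hH : IsFinslerMinkowskiNorm H) {p : ℝ} (hp : 1 < p) {G : E n → E n}
    (hG : MemLp G (ENNReal.ofReal p)) {ε : ℝ} (hε : 0 < ε) :
    ∃ R₀ > 0, ∃ δ > 0, ∀ R ≥ R₀, ∀ t, |t| ≤ δ →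
      |(∫ x, H (pullbackGrad R t G x) ^ p) - (1 + t * (p - n)) * ∫ x, H (G x) ^ p| ≤ ε * |t| := by
  obtain ⟨C₁, C₂, hC₁, hC₂, hb⟩ := hH.bounds
  have hc1 := hc.one_le
  have hc0 : 0 < c := by linarith
  obtain ⟨R₀, hR₀, δ, hδ, h⟩ := exists_abs_integral_sub_le_of_dilation_on_ball
    (hH.integrable_rpow hp hG) p n (c * (1 + C₂ / C₁)) hε
  refine ⟨R₀, hR₀, min δ (1 / (2 * c)), by positivity, fun R hR t ht => ?_⟩
  have hR0 : 0 < R := hR₀.trans_le hR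
  have htc : c * |t| ≤ 1 / 2 := by
    have := ht.trans (min_le_right _ _)
    rw [le_div_iff₀ (by positivity)] at this
    linarith
  have ht1 : |t| ≤ 1 / 2 := by
    have := abs_nonneg t
    nlinarith
  have hcc : c * |t| ≤ c * (1 + C₂ / C₁) * |t| := by
    gcongr
    have : 0 < C₂ / C₁ := by positivity
    nlinarith
  refine (h R hR t (ht.trans (min_le_left _ _)) (deform R t) (fun x => (deformDeriv R t x).det)
    (fun x => H (pullbackGrad R t G x) ^ p) (hc.isChangeOfVariables hR0 htc)
    (hH.integrable_rpow hp (memLp_pullbackGrad hc hR0 htc hp.le hG)).1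
    (fun x hx => hc.half_le_norm hR0 htc hx) fun x => ?_).2
  set ξ := G (deform R t x) with hξ
  have hJ := (hc.det R t x htc).trans hcc
  rcases eq_or_ne ξ 0 with h0 | h0
  -- both densities vanish, so the weight is arbitrary
  · refine ⟨1 + t, ?_, ?_, hJ, fun hx => ⟨rfl, det_deformDeriv_of_norm_lt t hx⟩⟩
    · rw [pullbackGrad, ← hξ, h0, map_zero, (hH.eq_zero_iff 0).2 rfl,
        Real.zero_rpow (by linarith), mul_zero]
    · rw [add_sub_cancel_left]
      refine le_trans ?_ hcc
      nlinarith [abs_nonneg t]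
  · have hpos : 0 < H ξ := (hH.nonneg ξ).lt_of_ne fun h => h0 ((hH.eq_zero_iff ξ).1 h.symm)
    refine ⟨H (pullbackGrad R t G x) / H ξ, ?_, ?_, hJ,
      fun hx => ⟨?_, det_deformDeriv_of_norm_lt t hx⟩⟩
    · rw [Real.div_rpow (hH.nonneg _) hpos.le, div_mul_cancel₀]
      exact (Real.rpow_pos_of_pos hpos p).ne'
    · rw [div_sub_one hpos.ne', abs_div, abs_of_pos hpos, div_le_iff₀ hpos]
      calc |H (pullbackGrad R t G x) - H ξ| ≤ H (pullbackGrad R t G x - ξ) := hH.abs_sub_le _ _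
        _ ≤ C₂ * (c * |t| * ‖ξ‖) := (hb _).2.trans (by
            gcongr
            exact norm_adjoint_deformDeriv_sub_le hc R t x ξ)
        _ ≤ C₂ * (c * |t| * (H ξ / C₁)) := by
            gcongr
            rw [le_div_iff₀ hC₁, mul_comm]
            exact (hb ξ).1
        _ = c * (C₂ / C₁) * |t| * H ξ := by field_simp
        _ ≤ _ := by
            gcongr
            linarith
    · have e : pullbackGrad R t G x = (1 + t) • ξ := by
        rw [pullbackGrad, deformDeriv_of_norm_lt t hx, ← hξ]
        have : ((1 + t) • (1 : E n →L[ℝ] E n)).adjoint = (1 + t) • (1 : E n →L[ℝ] E n) := by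
          have := star_smul (1 + t) (1 : E n →L[ℝ] E n)
          rw [star_one, star_trivial (1 + t)] at this
          exact this
        rw [this]
        simp
      rw [e, hH.homogeneous, mul_div_cancel_right₀ _ hpos.ne', abs_of_nonneg]
      linarith [(abs_le.1 ht1).1]

theorem aestronglyMeasurable_diffQuot {n : ℕ} (κ : ℝ) {u : E n → ℝ}
    (hu : AEStronglyMeasurable u) : AEStronglyMeasurable (diffQuot κ u) := by
  have h1 : AEStronglyMeasurable (fun z : E n × E n => u z.1)
    (volume : Measure (E n × E n)) := hu.comp_fst
  have h2 : AEStronglyMeasurable (fun z : E n × E n => u z.2)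
    (volume : Measure (E n × E n)) := hu.comp_snd
  have h3 : Measurable (fun z : E n × E n => ‖z.1 - z.2‖ ^ κ) :=
    (measurable_fst.sub measurable_snd).norm.pow_const κ
  exact ((h1.sub h2).aemeasurable.div h3.aemeasurable).aestronglyMeasurable

theorem memLp_diffQuot {n : ℕ} {s p : ℝ} {u : E n → ℝ} (hu : u ∈ sobolevWs n s p) :
    MemLp (diffQuot ((n : ℝ) / p + s) u) (ENNReal.ofReal p) := by
  refine hu.2.of_le (aestronglyMeasurable_diffQuot _ hu.1.1) (Eventually.of_forall fun z => ?_)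
  rw [diffQuot, norm_div, norm_div, Real.norm_eq_abs, Real.norm_eq_abs, Real.norm_eq_abs, abs_abs]

theorem gagliardoEnergy_eq {n : ℕ} {s p : ℝ} (hp : 1 < p) (u : E n → ℝ) :
    gagliardoEnergy s p u = ∫ z, |diffQuot ((n : ℝ) / p + s) u z| ^ p := by
  refine integral_congr_ae (Eventually.of_forall fun z => ?_)
  have h0 := norm_nonneg (z.1 - z.2)
  simp only [diffQuot]
  rw [abs_div, Real.div_rpow (abs_nonneg _) (abs_nonneg _), abs_of_nonneg (Real.rpow_nonneg h0 _),
    ← Real.rpow_mul h0]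
  congr 2
  field_simp

/-- The integrand of the nonlocal form is the product of `J p` of the difference quotient of `u` and
the difference quotient of `φ`, since `(n / p + s) p = n + s p`. On the diagonal both sides are
`0`. -/
theorem J_pairing_eq {n : ℕ} {s p : ℝ} (hp : 1 < p) (u φ : E n → ℝ) (z : E n × E n) :
    J p (u z.1 - u z.2) * (φ z.1 - φ z.2) / ‖z.1 - z.2‖ ^ ((n : ℝ) + s * p) =
      J p (diffQuot ((n : ℝ) / p + s) u z) * diffQuot ((n : ℝ) / p + s) φ z := by
  rcases eq_or_ne z.1 z.2 with h | h
  · simp [diffQuot, h]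
  · have hr : 0 < ‖z.1 - z.2‖ := norm_pos_iff.2 (sub_ne_zero.2 h)
    simp only [diffQuot]
    set r := ‖z.1 - z.2‖
    have hk : 0 < r ^ ((n : ℝ) / p + s) := by positivity
    have e : r ^ ((n : ℝ) + s * p) =
        (r ^ ((n : ℝ) / p + s)) ^ (p - 1) * r ^ ((n : ℝ) / p + s) := by
      rw [← Real.rpow_add_one hk.ne', sub_add_cancel, ← Real.rpow_mul hr.le]
      congr 1
      field_simp
    rw [div_eq_inv_mul (u z.1 - u z.2), J_mul (inv_pos.2 hk), Real.inv_rpow hk.le, e]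
    field_simp

theorem diffQuot_comp_deform {n : ℕ} {c R t : ℝ} (hc : DeformBound n c) (hR : 0 < R)
    (ht : c * |t| ≤ 1 / 2) (κ : ℝ) (u : E n → ℝ) {z : E n × E n} (hz : z.1 ≠ z.2) :
    diffQuot κ (fun x => u (deform R t x)) z =
      (‖deform R t z.1 - deform R t z.2‖ / ‖z.1 - z.2‖) ^ κ *
        diffQuot κ u (Prod.map (deform R t) (deform R t) z) := by
  have h1 : 0 < ‖z.1 - z.2‖ := norm_pos_iff.2 (sub_ne_zero.2 hz)
  have h2 : 0 < ‖deform R t z.1 - deform R t z.2‖ := by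
    have := hc.norm_le hR ht z.1 z.2
    linarith
  rw [diffQuot, diffQuot, Prod.map_fst, Prod.map_snd, Real.div_rpow h2.le h1.le]
  have h3 : 0 < ‖deform R t z.1 - deform R t z.2‖ ^ κ := by positivity
  field_simp

theorem abs_norm_div_sub_one_le {n : ℕ} {c R t : ℝ} (hc : DeformBound n c) (hR : 0 < R)
    {x y : E n} (hxy : x ≠ y) :
    |‖deform R t x - deform R t y‖ / ‖x - y‖ - 1| ≤ c * |t| := by
  have h1 : 0 < ‖x - y‖ := norm_pos_iff.2 (sub_ne_zero.2 hxy)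
  rw [div_sub_one h1.ne', abs_div, abs_of_pos h1, div_le_iff₀ h1]
  exact (abs_norm_sub_norm_le _ _).trans (hc.norm_sub R hR t x y)

/-- Variation of the Gagliardo energy along the truncated dilations. -/
theorem exists_abs_integral_diffQuot_deform_sub_le {n : ℕ} {c : ℝ} (hc : DeformBound n c)
    {κ p : ℝ} (hp : 1 < p) {u : E n → ℝ} (hu : AEStronglyMeasurable u)
    (hD : MemLp (diffQuot κ u) (ENNReal.ofReal p)) {ε : ℝ} (hε : 0 < ε) :
    ∃ R₀ > 0, ∃ δ > 0, ∀ R ≥ R₀, ∀ t, |t| ≤ δ →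
      |(∫ z, |diffQuot κ (fun x => u (deform R t x)) z| ^ p) -
        (1 + t * (κ * p - 2 * n)) * ∫ z, |diffQuot κ u z| ^ p| ≤ ε * |t| := by
  have hc1 := hc.one_le
  have hc0 : 0 < c := by linarith
  have hint : Integrable (fun z => |diffQuot κ u z| ^ p) := by
    have hi := hD.integrable_norm_rpow (by simp; linarith) ENNReal.ofReal_ne_top
    rwa [ENNReal.toReal_ofReal (by linarith)] at hi
  obtain ⟨R₀, hR₀, δ, hδ, h⟩ := exists_abs_integral_sub_le_of_dilation_on_ball
    hint (κ * p) (2 * n) (3 * c) hε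
  refine ⟨R₀, hR₀, min δ (1 / (2 * c)), by positivity, fun R hR t ht => ?_⟩
  have hR0 : 0 < R := hR₀.trans_le hR
  have htc : c * |t| ≤ 1 / 2 := by
    have := ht.trans (min_le_right _ _)
    rw [le_div_iff₀ (by positivity)] at this
    linarith
  have hct0 : 0 ≤ c * |t| := mul_nonneg hc0.le (abs_nonneg t)
  have ht1 : |t| ≤ 1 / 2 := by
    have := abs_nonneg t
    nlinarith
  have hum : AEStronglyMeasurable (fun x => u (deform R t x)) :=
    hu.comp_quasiMeasurePreserving (hc.isChangeOfVariables hR0 htc).quasiMeasurePreserving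
  have hWm : AEStronglyMeasurable (fun z => |diffQuot κ (fun x => u (deform R t x)) z| ^ p) :=
    ((aestronglyMeasurable_diffQuot κ hum).norm.aemeasurable.pow_const p).aestronglyMeasurable
  have hmain := (h R hR t (ht.trans (min_le_left _ _)) (Prod.map (deform R t) (deform R t))
    (fun z => (deformDeriv R t z.1).det * (deformDeriv R t z.2).det)
    (fun z => |diffQuot κ (fun x => u (deform R t x)) z| ^ p)
    (hc.isChangeOfVariables_prod hR0 htc) hWm (fun z hz => ?_) fun z => ?_).2
  · simpa using hmain
  · rw [Prod.norm_def] at hz ⊢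
    rcases le_max_iff.1 hz with h' | h'
    · exact (hc.half_le_norm hR0 htc h').trans (le_max_left _ _)
    · exact (hc.half_le_norm hR0 htc h').trans (le_max_right _ _)
  · have hd1 := hc.det R t z.1 htc
    have hd2 := hc.det R t z.2 htc
    have hJ : |(deformDeriv R t z.1).det * (deformDeriv R t z.2).det - 1| ≤ 3 * c * |t| := by
      rw [abs_le] at hd1 hd2 ⊢
      constructor <;> nlinarith
    have hJin : ‖z‖ < R → (deformDeriv R t z.1).det * (deformDeriv R t z.2).det =
        (1 + t) ^ (2 * n) := fun hz => by
      rw [Prod.norm_def, max_lt_iff] at hz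
      rw [det_deformDeriv_of_norm_lt t hz.1, det_deformDeriv_of_norm_lt t hz.2]
      ring
    by_cases hz : z.1 = z.2
    -- both quotients are `0` on the diagonal, so the weight is arbitrary
    · refine ⟨1 + t, ?_, ?_, hJ, fun hzR => ⟨rfl, hJin hzR⟩⟩
      · simp [diffQuot, hz, Real.zero_rpow (show p ≠ 0 by linarith)]
      · rw [add_sub_cancel_left]
        nlinarith [abs_nonneg t]
    · refine ⟨‖deform R t z.1 - deform R t z.2‖ / ‖z.1 - z.2‖, ?_, ?_, hJ,
        fun hzR => ⟨?_, hJin hzR⟩⟩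
      · have hq : 0 ≤ ‖deform R t z.1 - deform R t z.2‖ / ‖z.1 - z.2‖ := by positivity
        rw [diffQuot_comp_deform hc hR0 htc κ u hz, abs_mul,
          abs_of_nonneg (Real.rpow_nonneg hq _),
          Real.mul_rpow (Real.rpow_nonneg hq _) (abs_nonneg _), ← Real.rpow_mul hq]
      · refine (abs_norm_div_sub_one_le hc hR0 hz).trans ?_
        linarith
      · rw [Prod.norm_def, max_lt_iff] at hzR
        rw [deform_of_norm_lt t hzR.1, deform_of_norm_lt t hzR.2, ← smul_sub, norm_smul,
          mul_div_cancel_right₀ _ (norm_ne_zero_iff.2 (sub_ne_zero.2 hz)), Real.norm_of_nonneg]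
        linarith [(abs_le.1 ht1).1]

/-- Variation of the integral of a function transported by the truncated dilations. -/
theorem exists_abs_integral_comp_deform_sub_le {n : ℕ} {c : ℝ} (hc : DeformBound n c)
    {N : E n → ℝ} (hN : Integrable N) {ε : ℝ} (hε : 0 < ε) :
    ∃ R₀ > 0, ∃ δ > 0, ∀ R ≥ R₀, ∀ t, |t| ≤ δ →
      |(∫ x, N (deform R t x)) - (1 - t * n) * ∫ x, N x| ≤ ε * |t| := by
  have hc1 := hc.one_le
  have hc0 : 0 < c := by linarith
  obtain ⟨R₀, hR₀, δ, hδ, h⟩ := exists_abs_integral_sub_le_of_dilation_on_ball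
    hN 0 n c hε
  refine ⟨R₀, hR₀, min δ (1 / (2 * c)), by positivity, fun R hR t ht => ?_⟩
  have hR0 : 0 < R := hR₀.trans_le hR
  have htc : c * |t| ≤ 1 / 2 := by
    have := ht.trans (min_le_right _ _)
    rw [le_div_iff₀ (by positivity)] at this
    linarith
  have hmain := (h R hR t (ht.trans (min_le_left _ _)) (deform R t)
    (fun x => (deformDeriv R t x).det) (fun x => N (deform R t x))
    (hc.isChangeOfVariables hR0 htc)
    ((hc.isChangeOfVariables hR0 htc).integrable_comp hN).1
    (fun x hx => hc.half_le_norm hR0 htc hx) fun x => ⟨1 + t, by simp, ?_, hc.det R t x htc,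
      fun hx => ⟨rfl, det_deformDeriv_of_norm_lt t hx⟩⟩).2
  · simpa [sub_eq_add_neg] using hmain
  · rw [add_sub_cancel_left]
    nlinarith [abs_nonneg t]

/-! ### First-order expansion of the potential -/

/-- A modulus of continuity for `f` in terms of its growth. The oscillation of `f` on the interval
of radius `|h|` around `a` is split into a small constant, a term that lives where `|a|` is large,
and a power of `|h|`; only the last constant depends on `M` and `ε`. -/
theorem exists_abs_sub_le_of_growth {p : ℝ} (hp : 1 < p) {f : ℝ → ℝ} (hf : Continuous f)
    (hf₁ : ∃ C : ℝ, 0 < C ∧ ∀ t, |f t| ≤ C * |t| ^ (p - 1)) :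
    ∃ C₀ > 0, ∀ M ≥ 0, ∀ ε > 0, ∃ C' > 0, ∀ a h x : ℝ, |x - a| ≤ |h| →
      |f x - f a| ≤ ε + C₀ * (if M < |a| then |a| ^ (p - 1) else 0) + C' * |h| ^ (p - 1) := by
  obtain ⟨C, hC, hb⟩ := hf₁
  have hp1 : 0 < p - 1 := by linarith
  refine ⟨C * (2 ^ (p - 1) + 1), by positivity, fun M hM ε hε => ?_⟩
  set C₀ := C * (2 ^ (p - 1) + 1) with hC₀
  have hC₀p : 0 < C₀ := by positivity
  have hcrude : ∀ a h x : ℝ, |x - a| ≤ |h| →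
      |f x - f a| ≤ C₀ * (|a| ^ (p - 1) + |h| ^ (p - 1)) := by
    intro a h x hx
    have h1 : |x| ≤ 2 * max |a| |h| := by
      have := abs_add_le (x - a) a
      rw [sub_add_cancel] at this
      linarith [le_max_left |a| |h|, le_max_right |a| |h|]
    have h2 : |x| ^ (p - 1) ≤ 2 ^ (p - 1) * (|a| ^ (p - 1) + |h| ^ (p - 1)) := by
      have h0 : (0 : ℝ) ≤ max |a| |h| := (abs_nonneg a).trans (le_max_left _ _)
      calc |x| ^ (p - 1) ≤ (2 * max |a| |h|) ^ (p - 1) :=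
            Real.rpow_le_rpow (abs_nonneg _) h1 hp1.le
        _ = 2 ^ (p - 1) * (max |a| |h|) ^ (p - 1) := Real.mul_rpow (by norm_num) h0
        _ ≤ _ := by
          gcongr
          rcases max_choice |a| |h| with e | e <;> rw [e]
          · exact le_add_of_nonneg_right (by positivity)
          · exact le_add_of_nonneg_left (by positivity)
    have h3 : 0 ≤ |h| ^ (p - 1) := by positivity
    calc |f x - f a| ≤ |f x| + |f a| := abs_sub _ _
      _ ≤ C * (2 ^ (p - 1) * (|a| ^ (p - 1) + |h| ^ (p - 1))) + C * |a| ^ (p - 1) := by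
          gcongr
          · exact (hb x).trans (by gcongr)
          · exact hb a
      _ ≤ _ := by rw [hC₀]; nlinarith
  have huc : UniformContinuousOn f (Icc (-(M + 1)) (M + 1)) :=
    isCompact_Icc.uniformContinuousOn_of_continuous hf.continuousOn
  obtain ⟨δ, hδ, hu⟩ := Metric.uniformContinuousOn_iff.1 huc ε hε
  set η := min δ 1 with hη
  have hη0 : 0 < η := by positivity
  refine ⟨C₀ * ((M / η) ^ (p - 1) + 1), by positivity, fun a h x hx => ?_⟩
  have hh : 0 ≤ |h| ^ (p - 1) := by positivity
  have hMη : 0 ≤ (M / η) ^ (p - 1) := by positivity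
  split_ifs with hMa
  · refine (hcrude a h x hx).trans ?_
    have : C₀ * |h| ^ (p - 1) ≤ C₀ * ((M / η) ^ (p - 1) + 1) * |h| ^ (p - 1) := by
      gcongr
      nlinarith [mul_nonneg hC₀p.le hMη]
    linarith
  · rw [not_lt] at hMa
    rw [mul_zero, add_zero]
    rcases lt_or_ge |h| η with hhη | hhη
    · have ha := abs_le.1 hMa
      have hx1 := abs_le.1 (hx.trans (hhη.le.trans (min_le_right _ _)))
      have := hu x ⟨by linarith, by linarith⟩ a ⟨by linarith, by linarith⟩
        (by rw [Real.dist_eq]; exact hx.trans_lt (hhη.trans_le (min_le_left _ _)))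
      rw [Real.dist_eq] at this
      have h4 : 0 ≤ C₀ * ((M / η) ^ (p - 1) + 1) * |h| ^ (p - 1) := by positivity
      linarith
    · refine (hcrude a h x hx).trans ?_
      have h5 : |a| ^ (p - 1) ≤ (M / η) ^ (p - 1) * |h| ^ (p - 1) := by
        rw [← Real.mul_rpow (by positivity) (abs_nonneg h)]
        refine Real.rpow_le_rpow (abs_nonneg a) (hMa.trans ?_) hp1.le
        rw [div_mul_eq_mul_div, le_div_iff₀ hη0]
        gcongr
      have h6 := mul_le_mul_of_nonneg_left h5 hC₀p.le
      linarith

theorem abs_primitive_sub_le {f : ℝ → ℝ} (hf : Continuous f) (a h B : ℝ)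
    (hB : ∀ x, |x - a| ≤ |h| → |f x - f a| ≤ B) :
    |(∫ τ in (0 : ℝ)..(a + h), f τ) - (∫ τ in (0 : ℝ)..a, f τ) - f a * h| ≤ B * |h| := by
  have e : (∫ τ in (0 : ℝ)..(a + h), f τ) - (∫ τ in (0 : ℝ)..a, f τ) - f a * h =
      ∫ τ in a..(a + h), (f τ - f a) := by
    rw [intervalIntegral.integral_sub (hf.intervalIntegrable _ _) (by simp),
      intervalIntegral.integral_interval_sub_left (hf.intervalIntegrable _ _)
        (hf.intervalIntegrable _ _)]
    simp [mul_comm]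
  rw [e]
  have := intervalIntegral.norm_integral_le_of_norm_le_const (a := a) (b := a + h)
    (f := fun τ => f τ - f a) (C := B) fun x hx => ?_
  · simpa using this
  · refine hB x ?_
    have h1 := abs_sub_left_of_mem_uIcc (uIoc_subset_uIcc hx)
    simpa using h1

theorem abs_primitive_le {p : ℝ} (hp : 1 < p) {f : ℝ → ℝ} {C : ℝ} (hC : 0 ≤ C)
    (hb : ∀ t, |f t| ≤ C * |t| ^ (p - 1)) (a : ℝ) : |∫ τ in (0 : ℝ)..a, f τ| ≤ C * |a| ^ p := by
  have h1 := intervalIntegral.norm_integral_le_of_norm_le_const (a := 0) (b := a)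
    (f := f) (C := C * |a| ^ (p - 1)) fun x hx => by
      refine (hb x).trans ?_
      have h1 := abs_sub_left_of_mem_uIcc (uIoc_subset_uIcc hx)
      simp only [sub_zero] at h1
      gcongr
  rw [sub_zero, Real.norm_eq_abs] at h1
  refine h1.trans (le_of_eq ?_)
  rcases eq_or_ne a 0 with rfl | ha
  · simp [Real.zero_rpow (show p ≠ 0 by linarith)]
  · rw [mul_assoc, ← Real.rpow_add_one (abs_ne_zero.2 ha), sub_add_cancel]

theorem integrable_primitive_comp {Y : Type*} [MeasurableSpace Y] {μ : Measure Y} {p : ℝ}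
    (hp : 1 < p) {f : ℝ → ℝ} (hf : Continuous f)
    (hf₁ : ∃ C : ℝ, 0 < C ∧ ∀ t, |f t| ≤ C * |t| ^ (p - 1)) {u : Y → ℝ}
    (hu : MemLp u (ENNReal.ofReal p) μ) : Integrable (fun x => ∫ t in (0 : ℝ)..u x, f t) μ := by
  obtain ⟨C, hC, hb⟩ := hf₁
  have hi := hu.integrable_norm_rpow (by simp; linarith) ENNReal.ofReal_ne_top
  rw [ENNReal.toReal_ofReal (by linarith)] at hi
  have hF : Continuous fun a : ℝ => ∫ τ in (0 : ℝ)..a, f τ :=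
    intervalIntegral.continuous_primitive (fun a b => hf.intervalIntegrable a b) 0
  exact (hi.const_mul C).mono' (hF.comp_aestronglyMeasurable hu.1)
    (Eventually.of_forall fun x => abs_primitive_le hp hC.le hb (u x))

theorem memLp_rpow_sub_one {Y : Type*} [MeasurableSpace Y] {μ : Measure Y} {p q : ℝ}
    (hpq : p.HolderConjugate q) {g : Y → ℝ} (hg : MemLp g (ENNReal.ofReal p) μ) :
    MemLp (fun x => |g x| ^ (p - 1)) (ENNReal.ofReal q) μ := by
  have hp1 := hpq.sub_one_pos
  have h := hg.norm_rpow_div (ENNReal.ofReal (p - 1))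
  rw [ENNReal.toReal_ofReal hp1.le, ← ENNReal.ofReal_div_of_pos hp1,
    ← hpq.conjugate_eq] at h
  exact h

/-- A version of Hölder's inequality in which the norm of one factor is controlled by `b`. -/
theorem integral_mul_le_of_integral_rpow_le {Y : Type*} [MeasurableSpace Y] {μ : Measure Y}
    {p q : ℝ} (hpq : p.HolderConjugate q) {g h : Y → ℝ} (hg0 : ∀ x, 0 ≤ g x)
    (hg : MemLp g (ENNReal.ofReal q) μ) (hh : MemLp h (ENNReal.ofReal p) μ) {b : ℝ} (hb : 0 ≤ b)
    (hle : (∫ x, |h x| ^ p ∂μ) ≤ b ^ p) :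
    ∫ x, g x * |h x| ∂μ ≤ (∫ x, g x ^ q ∂μ) ^ (1 / q) * b := by
  have h1 := integral_mul_le_Lp_mul_Lq_of_nonneg hpq.symm (Eventually.of_forall hg0)
    (Eventually.of_forall fun x => abs_nonneg (h x)) hg hh.norm
  refine h1.trans ?_
  have h0 : 0 ≤ ∫ x, g x ^ q ∂μ := integral_nonneg fun x => Real.rpow_nonneg (hg0 x) _
  gcongr
  calc (∫ x, |h x| ^ p ∂μ) ^ (1 / p) ≤ (b ^ p) ^ (1 / p) := by
        have := hpq.pos
        gcongr
    _ = b := by rw [one_div, Real.rpow_rpow_inv hb hpq.ne_zero]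

theorem integral_rpow_le_of_eLpNorm_le {Y : Type*} [MeasurableSpace Y] {μ : Measure Y} {p : ℝ}
    (hp : 0 < p) {h : Y → ℝ} (hh : MemLp h (ENNReal.ofReal p) μ) {b : ℝ} (hb : 0 ≤ b)
    (hle : eLpNorm h (ENNReal.ofReal p) μ ≤ ENNReal.ofReal b) :
    ∫ x, |h x| ^ p ∂μ ≤ b ^ p := by
  rw [hh.eLpNorm_eq_integral_rpow_norm (by simpa using hp) ENNReal.ofReal_ne_top,
    ENNReal.ofReal_le_ofReal_iff hb, ENNReal.toReal_ofReal hp.le,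
    Real.rpow_inv_le_iff_of_pos (integral_nonneg fun x => by positivity) hb hp] at hle
  exact hle

/-- The mass of `g` on the superlevel sets of `|u|` tends to `0`, also after taking a power. -/
theorem exists_integral_superlevel_le {Y : Type*} [MeasurableSpace Y] {μ : Measure Y}
    {u g : Y → ℝ} (hu : AEStronglyMeasurable u μ) (hg : Integrable g μ) {r ε : ℝ} (hr : 0 < r)
    (hε : 0 < ε) :
    ∃ M ≥ (0 : ℝ), (∫ x, (if M < |u x| then g x else 0) ∂μ) ^ r ≤ ε := by
  have h : Tendsto (fun k : ℕ => ∫ x, (if (k : ℝ) < |u x| then g x else 0) ∂μ) atTop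
      (𝓝 (∫ _, (0 : ℝ) ∂μ)) := by
    refine tendsto_integral_of_dominated_convergence (fun x => |g x|) (fun k => ?_) hg.abs
      (fun k => Eventually.of_forall fun x => ?_) (Eventually.of_forall fun x => ?_)
    · have : NullMeasurableSet {x | (k : ℝ) < |u x|} μ :=
        nullMeasurableSet_lt aemeasurable_const hu.norm.aemeasurable
      exact (hg.1.indicator₀ this)
    · split_ifs <;> simp
    · obtain ⟨K, hK⟩ := exists_nat_gt |u x|
      refine tendsto_const_nhds.congr' ?_
      filter_upwards [eventually_ge_atTop K] with k hk
      rw [if_neg]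
      have : (K : ℝ) ≤ k := Nat.cast_le.2 hk
      linarith
  rw [integral_zero] at h
  have h2 := h.rpow_const (p := r) (Or.inr hr.le)
  rw [Real.zero_rpow hr.ne'] at h2
  obtain ⟨k, hk⟩ := (h2.eventually_le_const hε).exists
  exact ⟨k, Nat.cast_nonneg k, hk⟩

/-- First-order expansion of `∫ F(u)` under perturbations of `u` of `L^p` size `O(|t|)` with
support in a fixed set of finite measure. -/
theorem exists_abs_integral_primitive_sub_le {Y : Type*} [MeasurableSpace Y] {μ : Measure Y}
    {p : ℝ} (hp : 1 < p) {f : ℝ → ℝ} (hf : Continuous f)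
    (hf₁ : ∃ C : ℝ, 0 < C ∧ ∀ t, |f t| ≤ C * |t| ^ (p - 1)) {u : Y → ℝ}
    (hu : MemLp u (ENNReal.ofReal p) μ) {S : Set Y} (hS : MeasurableSet S) (hSf : μ S ≠ ⊤)
    {K : ℝ} (hK : 0 < K) {ε : ℝ} (hε : 0 < ε) :
    ∃ δ > 0, ∀ t : ℝ, |t| ≤ δ → ∀ h : Y → ℝ, MemLp h (ENNReal.ofReal p) μ →
      (∀ x ∉ S, h x = 0) → eLpNorm h (ENNReal.ofReal p) μ ≤ ENNReal.ofReal (K * |t|) →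
      |∫ x, ((∫ τ in (0 : ℝ)..(u x + h x), f τ) - (∫ τ in (0 : ℝ)..u x, f τ) - f (u x) * h x) ∂μ|
        ≤ ε * |t| := by
  have hp0 : 0 < p := by linarith
  obtain ⟨q, hpq⟩ : ∃ q, p.HolderConjugate q := ⟨_, Real.HolderConjugate.conjExponent hp⟩
  have hq0 : 0 < q := hpq.symm.pos
  obtain ⟨C₀, hC₀, hpt⟩ := exists_abs_sub_le_of_growth hp hf hf₁
  have hup : Integrable (fun x => |u x| ^ p) μ := by
    have hi := hu.integrable_norm_rpow (by simpa using hp0) ENNReal.ofReal_ne_top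
    rwa [ENNReal.toReal_ofReal hp0.le] at hi
  -- `M`, then the small constant of the modulus of continuity, then `δ` are chosen so that each of
  -- the three error terms of that modulus contributes at most `ε / 3 * |t|`
  obtain ⟨M, hM, hMle⟩ := exists_integral_superlevel_le hu.1 hup (r := 1 / q) (by positivity)
    (show 0 < ε / (3 * C₀ * K) by positivity)
  set V := (∫ x, (S.indicator (fun _ => (1 : ℝ)) x) ^ q ∂μ) ^ (1 / q) with hV
  have hV0 : 0 ≤ V := Real.rpow_nonneg (integral_nonneg fun x =>
    Real.rpow_nonneg (indicator_nonneg (fun _ _ => zero_le_one) x) _) _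
  obtain ⟨C', hC', hpt⟩ := hpt M hM (ε / (3 * (V + 1) * K)) (by positivity)
  refine ⟨(ε / (3 * C' * K ^ p)) ^ (1 / (p - 1)), by positivity, fun t ht h hh hhS hle => ?_⟩
  have hp1 : 0 < p - 1 := by linarith
  have ht0 := abs_nonneg t
  have hI := integral_rpow_le_of_eLpNorm_le hp0 hh (by positivity) hle
  set g₁ : Y → ℝ := S.indicator (fun _ => (1 : ℝ)) with hg₁
  set g₂ : Y → ℝ := fun x => if M < |u x| then |u x| ^ (p - 1) else 0 with hg₂
  have hg₁L : MemLp g₁ (ENNReal.ofReal q) μ := memLp_indicator_const _ hS _ (Or.inr hSf)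
  have hg₂L : MemLp g₂ (ENNReal.ofReal q) μ := by
    have hs : NullMeasurableSet {x | M < |u x|} μ :=
      nullMeasurableSet_lt aemeasurable_const hu.1.norm.aemeasurable
    have h1 := memLp_rpow_sub_one hpq hu
    refine h1.of_le (h1.1.indicator₀ hs) (Eventually.of_forall fun x => ?_)
    simp only [hg₂]
    split_ifs
    · exact le_rfl
    · simp
  have hg₁0 : ∀ x, 0 ≤ g₁ x := fun x => indicator_nonneg (fun _ _ => zero_le_one) x
  have hg₂0 : ∀ x, 0 ≤ g₂ x := fun x => by
    simp only [hg₂]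
    split_ifs
    · positivity
    · exact le_rfl
  have h1 := integral_mul_le_of_integral_rpow_le hpq hg₁0 hg₁L hh (b := K * |t|) (by positivity) hI
  have h2 := integral_mul_le_of_integral_rpow_le hpq hg₂0 hg₂L hh (b := K * |t|) (by positivity) hI
  have hg₂q : ∫ x, g₂ x ^ q ∂μ = ∫ x, (if M < |u x| then |u x| ^ p else 0) ∂μ := by
    refine integral_congr_ae (Eventually.of_forall fun x => ?_)
    simp only [hg₂]
    split_ifs
    · rw [← Real.rpow_mul (abs_nonneg _), hpq.sub_one_mul_conj]
    · exact Real.zero_rpow hq0.ne'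
  rw [hg₂q] at h2
  have hint : ∀ {g : Y → ℝ}, MemLp g (ENNReal.ofReal q) μ → Integrable (fun x => g x * |h x|) μ :=
    fun {g} hg => by
      have : ENNReal.HolderConjugate (ENNReal.ofReal q) (ENNReal.ofReal p) :=
        Real.HolderConjugate.ennrealOfReal hpq.symm
      exact hg.integrable_mul hh.norm
  have hhp : Integrable (fun x => |h x| ^ p) μ := by
    have hi := hh.integrable_norm_rpow (by simpa using hp0) ENNReal.ofReal_ne_top
    rwa [ENNReal.toReal_ofReal hp0.le] at hi
  have hbound : ∀ x, |(∫ τ in (0 : ℝ)..(u x + h x), f τ) - (∫ τ in (0 : ℝ)..u x, f τ) -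
      f (u x) * h x| ≤ ε / (3 * (V + 1) * K) * (g₁ x * |h x|) + C₀ * (g₂ x * |h x|) +
        C' * |h x| ^ p := by
    intro x
    have hb := abs_primitive_sub_le hf (u x) (h x) _ fun y hy => hpt (u x) (h x) y hy
    refine hb.trans (le_of_eq ?_)
    have e1 : |h x| = g₁ x * |h x| := by
      by_cases hx : x ∈ S
      · rw [hg₁, indicator_of_mem hx, one_mul]
      · rw [hhS x hx, abs_zero, mul_zero]
    have e2 : |h x| ^ (p - 1) * |h x| = |h x| ^ p := by
      rcases eq_or_ne (h x) 0 with h0 | h0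
      · simp [h0, Real.zero_rpow hp0.ne']
      · rw [← Real.rpow_add_one (abs_ne_zero.2 h0), sub_add_cancel]
    rw [← e1, ← e2]
    simp only [hg₂]
    ring
  have hi₁ := (hint hg₁L).const_mul (ε / (3 * (V + 1) * K))
  have hi₂ := (hint hg₂L).const_mul C₀
  have hi₃ := hhp.const_mul C'
  have hi₁₂ : Integrable (fun x => ε / (3 * (V + 1) * K) * (g₁ x * |h x|) +
      C₀ * (g₂ x * |h x|)) μ := hi₁.add hi₂
  rw [← Real.norm_eq_abs]
  refine (norm_integral_le_of_norm_le (hi₁₂.add hi₃)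
    (Eventually.of_forall fun x => hbound x)).trans ?_
  simp only [Pi.add_apply]
  rw [integral_add hi₁₂ hi₃, integral_add hi₁ hi₂, integral_const_mul, integral_const_mul,
    integral_const_mul]
  have b1 : ε / (3 * (V + 1) * K) * ∫ x, g₁ x * |h x| ∂μ ≤ ε / 3 * |t| := by
    calc _ ≤ ε / (3 * (V + 1) * K) * (V * (K * |t|)) := by gcongr
      _ ≤ ε / (3 * (V + 1) * K) * ((V + 1) * (K * |t|)) := by gcongr; linarith
      _ = _ := by field_simp
  have b2 : C₀ * ∫ x, g₂ x * |h x| ∂μ ≤ ε / 3 * |t| := by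
    calc _ ≤ C₀ * (ε / (3 * C₀ * K) * (K * |t|)) := by
          gcongr
          exact h2.trans (by gcongr)
      _ = _ := by field_simp
  have b3 : C' * ∫ x, |h x| ^ p ∂μ ≤ ε / 3 * |t| := by
    have e : (K * |t|) ^ p = K ^ p * (|t| ^ (p - 1) * |t|) := by
      rw [Real.mul_rpow hK.le ht0]
      congr 1
      rcases eq_or_ne t 0 with h0 | h0
      · simp [h0, Real.zero_rpow hp0.ne']
      · rw [← Real.rpow_add_one (abs_ne_zero.2 h0), sub_add_cancel]
    have e2 : |t| ^ (p - 1) ≤ ε / (3 * C' * K ^ p) := by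
      calc |t| ^ (p - 1) ≤ ((ε / (3 * C' * K ^ p)) ^ (1 / (p - 1))) ^ (p - 1) :=
            Real.rpow_le_rpow ht0 ht hp1.le
        _ = _ := by
          rw [one_div, Real.rpow_inv_rpow (by positivity) hp1.ne']
    calc _ ≤ C' * (K ^ p * (|t| ^ (p - 1) * |t|)) := by rw [← e]; gcongr
      _ ≤ C' * (K ^ p * (ε / (3 * C' * K ^ p) * |t|)) := by gcongr
      _ = _ := by field_simp
  linarith

/-! ### Approximation of displaced functions -/

/-- A sequence of bumps shrinking to the origin. -/
def bumpSeq (n k : ℕ) : ContDiffBump (0 : E n) where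
  rIn := 1 / 2 / ((k : ℝ) + 1)
  rOut := 1 / ((k : ℝ) + 1)
  rIn_pos := by positivity
  rIn_lt_rOut := by gcongr; norm_num

theorem tendsto_rOut_bumpSeq (n : ℕ) : Tendsto (fun k => (bumpSeq n k).rOut) atTop (𝓝 0) :=
  tendsto_one_div_add_atTop_nhds_zero_nat

theorem tendsto_eLpNorm_mollify_bumpSeq_sub {n : ℕ} {F : Type*} [NormedAddCommGroup F]
    [NormedSpace ℝ F] [CompleteSpace F] {p : ℝ} (hp : 1 ≤ p) {g : E n → F}
    (hg : MemLp g (ENNReal.ofReal p)) :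
    Tendsto (fun k => eLpNorm (fun x => mollify (bumpSeq n k) g x - g x) (ENNReal.ofReal p) volume)
      atTop (𝓝 0) :=
  tendsto_eLpNorm_mollify_sub volume hp hg (ι := fun h : E n => h) continuous_id rfl
    (tendsto_rOut_bumpSeq n)

/-- Mollifying `u` mollifies its difference quotient along the diagonal of `ℝⁿ × ℝⁿ`. -/
theorem diffQuot_mollify {n : ℕ} (φ : ContDiffBump (0 : E n)) (κ : ℝ) {u : E n → ℝ}
    (hu : LocallyIntegrable u) (z : E n × E n) :
    diffQuot κ (mollify φ u) z = ∫ h, φ.normed volume h • diffQuot κ u (z - (h, h)) := by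
  rw [diffQuot, mollify, mollify, ← integral_sub (integrable_mollify_integrand φ hu z.1)
    (integrable_mollify_integrand φ hu z.2), ← integral_div]
  refine integral_congr_ae (Eventually.of_forall fun h => ?_)
  simp only [diffQuot, Prod.fst_sub, Prod.snd_sub, smul_eq_mul, sub_sub_sub_cancel_right]
  ring

theorem diffQuot_sub {n : ℕ} (κ : ℝ) (u v : E n → ℝ) (z : E n × E n) :
    diffQuot κ (fun x => u x - v x) z = diffQuot κ u z - diffQuot κ v z := by
  simp only [diffQuot]; ring

instance isAddHaarMeasure_volume_prod (n : ℕ) :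
    (volume : Measure (E n × E n)).IsAddHaarMeasure :=
  inferInstanceAs ((volume : Measure (E n)).prod (volume : Measure (E n))).IsAddHaarMeasure

theorem tendsto_eLpNorm_diffQuot_mollify_sub {n : ℕ} {κ p : ℝ} (hp : 1 ≤ p) {u : E n → ℝ}
    (hu : LocallyIntegrable u) (hD : MemLp (diffQuot κ u) (ENNReal.ofReal p)) :
    Tendsto (fun k => eLpNorm (fun z => diffQuot κ (mollify (bumpSeq n k) u) z - diffQuot κ u z)
      (ENNReal.ofReal p) volume) atTop (𝓝 0) := by
  have h := tendsto_eLpNorm_mollify_sub (volume : Measure (E n × E n)) hp hD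
    (ι := fun h : E n => (h, h)) (continuous_id.prodMk continuous_id) rfl
    (tendsto_rOut_bumpSeq n)
  simpa only [diffQuot_mollify _ _ hu] using! h

theorem gradient_comp_deform {n : ℕ} {R : ℝ} (hR : 0 < R) (t : ℝ) {w : E n → ℝ}
    (hw : ContDiff ℝ 1 w) (x : E n) :
    gradient (fun y => w (deform R t y)) x = pullbackGrad R t (gradient w) x := by
  have h1 := ((hw.differentiable one_ne_zero (deform R t x)).hasFDerivAt).comp x
    (hasFDerivAt_deform hR t x)
  refine ext_inner_right ℝ fun v => ?_
  rw [inner_gradient_left, pullbackGrad, ContinuousLinearMap.adjoint_inner_left,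
    inner_gradient_left]
  have e : fderiv ℝ (fun y => w (deform R t y)) x = _ := h1.fderiv
  rw [e]; rfl

theorem eLpNorm_pullbackGrad_le {n : ℕ} {c R t p : ℝ} (hc : DeformBound n c) (hR : 0 < R)
    (ht : c * |t| ≤ 1 / 2) (hp : 1 ≤ p) {G : E n → E n} (hG : AEStronglyMeasurable G) :
    eLpNorm (pullbackGrad R t G) (ENNReal.ofReal p) volume ≤
      8 * eLpNorm G (ENNReal.ofReal p) volume := by
  refine (eLpNorm_le_mul_eLpNorm_of_ae_le_mul
    (Eventually.of_forall fun x => norm_pullbackGrad_le hc ht G x) _).trans ?_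
  calc _ ≤ ENNReal.ofReal 2 * (4 * eLpNorm G (ENNReal.ofReal p) volume) := by
        gcongr
        exact (hc.isChangeOfVariables hR ht).eLpNorm_comp_le hp hG
    _ = _ := by
      rw [← mul_assoc]
      congr 1
      norm_num

theorem eLpNorm_diffQuot_comp_deform_le {n : ℕ} {c R t p κ : ℝ} (hc : DeformBound n c)
    (hR : 0 < R) (ht : c * |t| ≤ 1 / 2) (hp : 1 ≤ p) (hκ : 0 ≤ κ) {u : E n → ℝ}
    (hu : AEStronglyMeasurable u) :
    eLpNorm (diffQuot κ (fun x => u (deform R t x))) (ENNReal.ofReal p) volume ≤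
      ENNReal.ofReal (2 ^ κ) * (4 * eLpNorm (diffQuot κ u) (ENNReal.ofReal p) volume) := by
  refine (eLpNorm_le_mul_eLpNorm_of_ae_le_mul (c := 2 ^ κ)
    (g := fun z => diffQuot κ u (Prod.map (deform R t) (deform R t) z))
    (Eventually.of_forall fun z => ?_) _).trans ?_
  · by_cases hz : z.1 = z.2
    · have : (0 : ℝ) ≤ 2 ^ κ := by positivity
      simp [diffQuot, hz]
    · rw [diffQuot_comp_deform hc hR ht κ u hz, norm_mul]
      gcongr
      have hq : 0 ≤ ‖deform R t z.1 - deform R t z.2‖ / ‖z.1 - z.2‖ := by positivity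
      rw [Real.norm_of_nonneg (Real.rpow_nonneg hq _)]
      refine Real.rpow_le_rpow hq ?_ hκ
      have := (abs_le.1 (abs_norm_div_sub_one_le (t := t) hc hR hz)).2
      linarith
  · gcongr
    exact (hc.isChangeOfVariables_prod hR ht).eLpNorm_comp_le hp
      (aestronglyMeasurable_diffQuot κ hu)

theorem memLp_diffQuot_comp_deform {n : ℕ} {c R t p κ : ℝ} (hc : DeformBound n c)
    (hR : 0 < R) (ht : c * |t| ≤ 1 / 2) (hp : 1 ≤ p) (hκ : 0 ≤ κ) {u : E n → ℝ}
    (hu : AEStronglyMeasurable u) (hD : MemLp (diffQuot κ u) (ENNReal.ofReal p)) :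
    MemLp (diffQuot κ (fun x => u (deform R t x))) (ENNReal.ofReal p) := by
  refine ⟨aestronglyMeasurable_diffQuot κ (hu.comp_quasiMeasurePreserving
    (hc.isChangeOfVariables hR ht).quasiMeasurePreserving), ?_⟩
  refine (eLpNorm_diffQuot_comp_deform_le hc hR ht hp hκ hu).trans_lt ?_
  exact ENNReal.mul_lt_top ENNReal.ofReal_lt_top (ENNReal.mul_lt_top (by simp) hD.2)

/-! ### Displacements in `L^p` -/

theorem norm_radialField_le {n : ℕ} {R : ℝ} (hR : 0 < R) (x : E n) : ‖radialField R x‖ ≤ 2 * R := by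
  rcases le_or_gt (2 * R) ‖x‖ with hx | hx
  · rw [radialField_of_le_norm hR hx, norm_zero]; positivity
  · rw [radialField, norm_smul, Real.norm_of_nonneg (cutoff n).nonneg]
    have := (cutoff n).le_one (x := R⁻¹ • x)
    nlinarith [norm_nonneg x]

theorem continuous_radialField {n : ℕ} {R : ℝ} (hR : 0 < R) : Continuous (radialField (n := n) R) :=
  continuous_iff_continuousAt.2 fun x => (hasFDerivAt_radialField hR x).continuousAt

/-- Moving a `C¹` function along the truncated field changes it in `L^p` by at most a multiple of
`|t|` times the `L^p` norm of its gradient. -/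
theorem eLpNorm_comp_deform_sub_le {n : ℕ} {c R t p : ℝ} (hc : DeformBound n c) (hR : 0 < R)
    (ht : c * |t| ≤ 1 / 2) (hp : 1 ≤ p) {w : E n → ℝ} (hw : ContDiff ℝ 1 w) :
    eLpNorm (fun x => w (deform R t x) - w x) (ENNReal.ofReal p) volume ≤
      ENNReal.ofReal (8 * R * |t|) * eLpNorm (gradient w) (ENNReal.ofReal p) volume := by
  set ν : Measure ℝ := volume.restrict (Ioc (0 : ℝ) 1) with hν
  have : IsProbabilityMeasure ν := ⟨by simp [hν]⟩
  have hg : Continuous (gradient w) :=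
    (InnerProductSpace.toDual ℝ (E n)).symm.continuous.comp (hw.continuous_fderiv one_ne_zero)
  have hdef : Continuous (fun z : ℝ × E n => deform R (z.1 * t) z.2) := by
    have := (continuous_radialField (n := n) hR)
    unfold deform
    fun_prop
  have hk : Continuous (fun z : ℝ × E n => ‖gradient w (deform R (z.1 * t) z.2)‖) :=
    (hg.comp hdef).norm
  have havg := eLpNorm_average_le ν (volume : Measure (E n)) hp
    (k := fun z : ℝ × E n => ‖gradient w (deform R (z.1 * t) z.2)‖)
    hk.aestronglyMeasurable (ε := 4 * eLpNorm (gradient w) (ENNReal.ofReal p) volume) (by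
      rw [hν]
      filter_upwards [ae_restrict_mem measurableSet_Ioc] with θ hθ
      have htθ : c * |θ * t| ≤ 1 / 2 := by
        rw [abs_mul, abs_of_pos hθ.1]
        have := hc.one_le
        have h0 : 0 ≤ c * |t| := mul_nonneg (by linarith) (abs_nonneg t)
        nlinarith [hθ.2, hθ.1]
      simp only [eLpNorm_norm]
      exact (hc.isChangeOfVariables hR htθ).eLpNorm_comp_le hp hg.aestronglyMeasurable)
  have hpt : ∀ x, ‖w (deform R t x) - w x‖ ≤
      2 * R * |t| * ‖∫ θ, ‖gradient w (deform R (θ * t) x)‖ ∂ν‖ := by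
    intro x
    have hd : ∀ θ ∈ uIcc (0 : ℝ) 1, HasDerivAt (fun θ : ℝ => w (deform R (θ * t) x))
        (⟪gradient w (deform R (θ * t) x), t • radialField R x⟫) θ := by
      intro θ _
      have h1 : HasDerivAt (fun θ : ℝ => deform R (θ * t) x) (t • radialField R x) θ := by
        have := (((hasDerivAt_id θ).mul_const t).smul_const (radialField R x)).const_add x
        simpa [deform] using this
      have h2 := (hw.differentiable one_ne_zero (deform R (θ * t) x)).hasFDerivAt
      rw [inner_gradient_left]
      exact h2.comp_hasDerivAt θ h1
    have hx : Continuous fun θ : ℝ => gradient w (deform R (θ * t) x) :=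
      hg.comp (hdef.comp (continuous_id.prodMk continuous_const))
    have hftc := intervalIntegral.integral_eq_sub_of_hasDerivAt hd
      ((hx.inner continuous_const).intervalIntegrable _ _)
    simp only [one_mul, zero_mul] at hftc
    rw [show deform R 0 x = x by simp [deform]] at hftc
    rw [← hftc, Real.norm_of_nonneg (integral_nonneg fun _ => norm_nonneg _), hν,
      ← integral_const_mul]
    refine (intervalIntegral.norm_integral_le_integral_norm zero_le_one).trans ?_
    rw [intervalIntegral.integral_of_le zero_le_one]
    refine integral_mono ((hx.inner continuous_const).norm.integrableOn_Ioc)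
      ((hx.norm.const_mul _).integrableOn_Ioc) fun θ => ?_
    refine (norm_inner_le_norm _ _).trans ?_
    rw [norm_smul, Real.norm_eq_abs, mul_comm]
    have := norm_radialField_le hR x
    have h0 := abs_nonneg t
    change |t| * ‖radialField R x‖ * _ ≤ 2 * R * |t| * _
    refine mul_le_mul_of_nonneg_right ?_ (norm_nonneg _)
    nlinarith
  have h1 := eLpNorm_le_mul_eLpNorm_of_ae_le_mul (p := ENNReal.ofReal p)
    (μ := (volume : Measure (E n))) (Eventually.of_forall hpt)
  refine h1.trans ?_
  calc _ ≤ ENNReal.ofReal (2 * R * |t|) *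
        (4 * eLpNorm (gradient w) (ENNReal.ofReal p) volume) := by gcongr
    _ = _ := by
      rw [← mul_assoc, show (4 : ENNReal) = ENNReal.ofReal 4 by simp,
        ← ENNReal.ofReal_mul (by positivity)]
      congr 2; ring

/-- In `W^{1,p}`, moving along the truncated field changes a function by `O(|t|)` in `L^p`. -/
theorem eLpNorm_comp_deform_sub_le_of_isWeakGradient {n : ℕ} {c R t p : ℝ} (hc : DeformBound n c)
    (hR : 0 < R) (ht : c * |t| ≤ 1 / 2) (hp : 1 ≤ p) {u : E n → ℝ} {G : E n → E n}
    (hu : MemLp u (ENNReal.ofReal p)) (hG : IsWeakGradient u G) (hGp : MemLp G (ENNReal.ofReal p)) :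
    eLpNorm (fun x => u (deform R t x) - u x) (ENNReal.ofReal p) volume ≤
      ENNReal.ofReal (8 * R * |t|) * eLpNorm G (ENNReal.ofReal p) volume := by
  set q := ENNReal.ofReal p with hq
  have hq1 : 1 ≤ q := by simpa [hq] using hp
  set uk := fun k => mollify (bumpSeq n k) u with huk
  set a := fun k => eLpNorm (fun x => uk k x - u x) q volume with ha
  set b := fun k => eLpNorm (fun x => mollify (bumpSeq n k) G x - G x) q volume with hb
  have ha0 : Tendsto a atTop (𝓝 0) := tendsto_eLpNorm_mollify_bumpSeq_sub hp hu
  have hb0 : Tendsto b atTop (𝓝 0) := tendsto_eLpNorm_mollify_bumpSeq_sub hp hGp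
  have hcv := hc.isChangeOfVariables hR ht
  have hukc : ∀ k, ContDiff ℝ 1 (uk k) := fun k => contDiff_mollify _ hG.1
  have hgrad : ∀ k, gradient (uk k) = mollify (bumpSeq n k) G := fun k =>
    funext fun x => gradient_mollify _ hG x
  have hmG : ∀ k, AEStronglyMeasurable (mollify (bumpSeq n k) G) volume := fun k => by
    rw [← hgrad]
    exact ((InnerProductSpace.toDual ℝ (E n)).symm.continuous.comp
      ((hukc k).continuous_fderiv one_ne_zero)).aestronglyMeasurable
  have hle : ∀ k, eLpNorm (fun x => u (deform R t x) - u x) q volume ≤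
      4 * a k + (ENNReal.ofReal (8 * R * |t|) * (b k + eLpNorm G q volume) + a k) := by
    intro k
    have hum : AEStronglyMeasurable (fun x => u (deform R t x)) volume :=
      (hcv.memLp_comp hp hu).1
    have hukm : AEStronglyMeasurable (fun x => uk k (deform R t x)) volume :=
      ((hukc k).continuous.comp (continuous_deform hR t)).aestronglyMeasurable
    have hukm' : AEStronglyMeasurable (uk k) volume := (hukc k).continuous.aestronglyMeasurable
    have e : (fun x => u (deform R t x) - u x) = (fun x => u (deform R t x) - uk k (deform R t x)) +
        ((fun x => uk k (deform R t x) - uk k x) + fun x => uk k x - u x) := by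
      funext x; simp
    rw [e]
    refine (eLpNorm_add_le (hum.sub hukm) ((hukm.sub hukm').add (hukm'.sub hu.1)) hq1).trans ?_
    gcongr
    · have := hcv.eLpNorm_comp_le hp (g := fun x => u x - uk k x) (hu.1.sub hukm')
      refine this.trans (le_of_eq ?_)
      congr 1
      exact eLpNorm_sub_comm u (uk k) q volume
    · refine (eLpNorm_add_le (hukm.sub hukm') (hukm'.sub hu.1) hq1).trans ?_
      refine add_le_add ?_ le_rfl
      refine (eLpNorm_comp_deform_sub_le hc hR ht hp (hukc k)).trans ?_
      rw [hgrad]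
      gcongr
      have e2 : mollify (bumpSeq n k) G = (fun x => mollify (bumpSeq n k) G x - G x) + G := by
        funext x; simp
      conv_lhs => rw [e2]
      exact eLpNorm_add_le ((hmG k).sub hGp.1) hGp.1 hq1
  have hlim : Tendsto (fun k => 4 * a k +
      (ENNReal.ofReal (8 * R * |t|) * (b k + eLpNorm G q volume) + a k)) atTop
      (𝓝 (4 * 0 + (ENNReal.ofReal (8 * R * |t|) * (0 + eLpNorm G q volume) + 0))) :=
    (ENNReal.Tendsto.const_mul ha0 (Or.inr (by simp))).add
      ((ENNReal.Tendsto.const_mul (hb0.add tendsto_const_nhds)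
        (Or.inr ENNReal.ofReal_ne_top)).add ha0)
  simp only [mul_zero, zero_add, add_zero] at hlim
  exact ge_of_tendsto' hlim hle

/-- A `C¹` function changes by `O(|t|)` in `L^p` along the truncated field, which vanishes far
away. -/
theorem exists_eLpNorm_comp_deform_sub_le_of_contDiff {n : ℕ} {c R p : ℝ} (hc : DeformBound n c)
    (hR : 0 < R) (hp : 1 ≤ p) {u : E n → ℝ} (hu : ContDiff ℝ 1 u) :
    ∃ K : ℝ, ∀ t, c * |t| ≤ 1 / 2 →
      eLpNorm (fun x => u (deform R t x) - u x) (ENNReal.ofReal p) volume ≤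
        ENNReal.ofReal (K * |t|) := by
  set B : Set (E n) := Metric.closedBall 0 (4 * R) with hB
  obtain ⟨L, hL⟩ := (isCompact_closedBall (0 : E n) (4 * R)).exists_bound_of_continuousOn
    (hu.continuous_fderiv one_ne_zero).continuousOn
  set V := (volume B) ^ (1 / p) with hV
  have hVt : V ≠ ⊤ := ENNReal.rpow_ne_top_of_nonneg (by positivity)
    (isCompact_closedBall (0 : E n) (4 * R)).measure_lt_top.ne
  have hL0 : 0 ≤ max L 0 := le_max_right _ _
  refine ⟨max L 0 * (2 * R) * V.toReal, fun t ht => ?_⟩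
  have hpt : ∀ x, ‖u (deform R t x) - u x‖ ≤
      ‖B.indicator (fun _ => max L 0 * (2 * R) * |t|) x‖ := by
    intro x
    rcases le_or_gt (2 * R) ‖x‖ with hx | hx
    · rw [deform_of_le_norm hR t hx, sub_self, norm_zero]; positivity
    · have hxB : x ∈ B := by rw [hB, mem_closedBall_zero_iff]; linarith
      have hf := norm_radialField_le hR x
      have ht1 : |t| ≤ 1 / 2 := by
        have := hc.one_le
        nlinarith [abs_nonneg t]
      have hd : ‖deform R t x - x‖ ≤ 2 * R * |t| := by
        rw [deform, add_sub_cancel_left, norm_smul, Real.norm_eq_abs]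
        nlinarith [abs_nonneg t]
      have hdB : deform R t x ∈ B := by
        rw [hB, mem_closedBall_zero_iff]
        have := norm_le_norm_add_norm_sub' (deform R t x) x
        nlinarith
      have := (convex_closedBall (0 : E n) (4 * R)).norm_image_sub_le_of_norm_fderiv_le
        (fun y _ => hu.differentiable one_ne_zero y) (fun y hy => (hL y hy).trans (le_max_left L 0))
        hxB hdB
      rw [indicator_of_mem hxB, Real.norm_of_nonneg (r := _ * _) (by positivity)]
      refine this.trans ?_
      rw [mul_assoc]
      gcongr
  refine (eLpNorm_mono hpt).trans ?_
  rw [eLpNorm_indicator_const Metric.isClosed_closedBall.measurableSet (by simp; linarith)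
    ENNReal.ofReal_ne_top, ENNReal.toReal_ofReal (by linarith), ← hV,
    Real.enorm_of_nonneg (by positivity), mul_right_comm (_ * _) V.toReal |t|,
    ENNReal.ofReal_mul (q := V.toReal) (by positivity), ENNReal.ofReal_toReal hVt]

/-- The displacement of `u` along the truncated field is `O(|t|)` in `L^p`. -/
theorem exists_eLpNorm_comp_deform_sub_le {n : ℕ} {c R p : ℝ} (hc : DeformBound n c)
    (hR : 0 < R) (hp : 1 ≤ p) {u : E n → ℝ} (hu : u ∈ sobolevW1 n p ∨ ContDiff ℝ 1 u) :
    ∃ K > 0, ∀ t, c * |t| ≤ 1 / 2 →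
      eLpNorm (fun x => u (deform R t x) - u x) (ENNReal.ofReal p) volume ≤
        ENNReal.ofReal (K * |t|) := by
  obtain ⟨K, hK⟩ : ∃ K : ℝ, ∀ t, c * |t| ≤ 1 / 2 →
      eLpNorm (fun x => u (deform R t x) - u x) (ENNReal.ofReal p) volume ≤
        ENNReal.ofReal (K * |t|) := by
    rcases hu with hu | hu
    · obtain ⟨hG, hGp⟩ := isWeakGradient_weakGradient hu
      refine ⟨8 * R * (eLpNorm (weakGradient u) (ENNReal.ofReal p) volume).toReal, fun t ht => ?_⟩
      refine (eLpNorm_comp_deform_sub_le_of_isWeakGradient hc hR ht hp hu.1 hG hGp).trans ?_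
      rw [mul_right_comm (8 * R), ENNReal.ofReal_mul (p := 8 * R * |t|) (by positivity),
        ENNReal.ofReal_toReal hGp.2.ne]
    · exact exists_eLpNorm_comp_deform_sub_le_of_contDiff hc hR hp hu
  refine ⟨max K 1, by positivity, fun t ht => (hK t ht).trans ?_⟩
  gcongr
  exact le_max_left _ _

/-! ### Duality pairings -/

theorem integrable_bilin {Y F : Type*} [MeasurableSpace Y] {μ : Measure Y}
    [NormedAddCommGroup F] [NormedSpace ℝ F] {p q : ℝ} (hpq : p.HolderConjugate q)
    (B : F →L[ℝ] F →L[ℝ] ℝ) {b W : Y → F} (hb : MemLp b (ENNReal.ofReal q) μ)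
    (hW : MemLp W (ENNReal.ofReal p) μ) : Integrable (fun x => B (b x) (W x)) μ := by
  have hconj : ENNReal.HolderConjugate (ENNReal.ofReal q) (ENNReal.ofReal p) :=
    Real.HolderConjugate.ennrealOfReal hpq.symm
  rw [← memLp_one_iff_integrable]
  exact hb.of_bilin (fun x y => B x y) ‖B‖₊ hW (B.aestronglyMeasurable_comp₂ hb.1 hW.1)
    (Eventually.of_forall fun x => B.le_opNorm₂ _ _)

/-- Continuity of the duality pairing between `L^q` and `L^p`. -/
theorem tendsto_integral_bilin {Y F : Type*} [MeasurableSpace Y] {μ : Measure Y}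
    [NormedAddCommGroup F] [NormedSpace ℝ F] {p q : ℝ} (hpq : p.HolderConjugate q)
    (B : F →L[ℝ] F →L[ℝ] ℝ) {b : Y → F} (hb : MemLp b (ENNReal.ofReal q) μ)
    {V : Y → F} {Vk : ℕ → Y → F} (hV : MemLp V (ENNReal.ofReal p) μ)
    (hVk : ∀ k, AEStronglyMeasurable (Vk k) μ)
    (h : Tendsto (fun k => eLpNorm (fun x => Vk k x - V x) (ENNReal.ofReal p) μ) atTop (𝓝 0)) :
    Tendsto (fun k => ∫ x, B (b x) (Vk k x) ∂μ) atTop (𝓝 (∫ x, B (b x) (V x) ∂μ)) := by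
  have hconj : ENNReal.HolderConjugate (ENNReal.ofReal q) (ENNReal.ofReal p) :=
    Real.HolderConjugate.ennrealOfReal hpq.symm
  have hle : ∀ x y : F, ‖B x y‖ ≤ ‖B‖₊ * ‖x‖ * ‖y‖ := fun x y => B.le_opNorm₂ x y
  have hbound : ∀ k, eLpNorm (fun x => B (b x) (Vk k x) - B (b x) (V x)) 1 μ ≤
      ‖B‖₊ * eLpNorm b (ENNReal.ofReal q) μ *
        eLpNorm (fun x => Vk k x - V x) (ENNReal.ofReal p) μ := fun k => by
    simp only [← map_sub]
    exact eLpNorm_le_eLpNorm_mul_eLpNorm_of_nnnorm hb.1 ((hVk k).sub hV.1) (fun x y => B x y) ‖B‖₊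
      (Eventually.of_forall fun x => hle _ _)
  have hfin : (‖B‖₊ * eLpNorm b (ENNReal.ofReal q) μ : ENNReal) ≠ ⊤ :=
    ENNReal.mul_ne_top ENNReal.coe_ne_top hb.2.ne
  refine tendsto_integral_of_L1' _ (integrable_bilin hpq B hb hV).1 ?_ ?_
  · filter_upwards [h.eventually_lt_const (show (0 : ENNReal) < 1 by simp)] with k hk
    have hd : MemLp (fun x => Vk k x - V x) (ENNReal.ofReal p) μ :=
      ⟨(hVk k).sub hV.1, hk.trans ENNReal.one_lt_top⟩
    refine (integrable_bilin hpq B hb (hd.add hV)).congr (Eventually.of_forall fun x => ?_)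
    simp
  · refine tendsto_of_tendsto_of_tendsto_of_le_of_le tendsto_const_nhds ?_ (fun _ => zero_le)
      hbound
    have := ENNReal.Tendsto.const_mul (a := ‖B‖₊ * eLpNorm b (ENNReal.ofReal q) μ) h
      (Or.inr hfin)
    simpa using this

theorem tendsto_of_le_mul {a b : ℕ → ENNReal} {C : ENNReal} (hC : C ≠ ⊤)
    (ha : Tendsto a atTop (𝓝 0)) (h : ∀ k, b k ≤ C * a k) : Tendsto b atTop (𝓝 0) := by
  refine tendsto_of_tendsto_of_tendsto_of_le_of_le tendsto_const_nhds ?_ (fun _ => zero_le) h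
  simpa using ENNReal.Tendsto.const_mul ha (Or.inr hC)

theorem measurable_J (p : ℝ) : Measurable (J p) := by
  unfold J
  fun_prop

theorem memLp_J_comp {Y : Type*} [MeasurableSpace Y] {μ : Measure Y} {p q : ℝ}
    (hpq : p.HolderConjugate q) {g : Y → ℝ} (hg : MemLp g (ENNReal.ofReal p) μ) :
    MemLp (fun x => J p (g x)) (ENNReal.ofReal q) μ := by
  refine (memLp_rpow_sub_one hpq hg).of_le
    ((measurable_J p).comp_aemeasurable hg.1.aemeasurable).aestronglyMeasurable
    (Eventually.of_forall fun x => ?_)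
  rw [Real.norm_eq_abs, abs_J hpq.lt]
  exact le_abs_self _

theorem memLp_comp_of_growth {Y : Type*} [MeasurableSpace Y] {μ : Measure Y} {p q : ℝ}
    (hpq : p.HolderConjugate q) {f : ℝ → ℝ} (hf : Continuous f)
    (hf₁ : ∃ C : ℝ, 0 < C ∧ ∀ t, |f t| ≤ C * |t| ^ (p - 1)) {u : Y → ℝ}
    (hu : MemLp u (ENNReal.ofReal p) μ) : MemLp (fun x => f (u x)) (ENNReal.ofReal q) μ := by
  obtain ⟨C, -, hb⟩ := hf₁
  refine (memLp_rpow_sub_one hpq hu).of_le_mul (c := C) (hf.comp_aestronglyMeasurable hu.1)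
    (Eventually.of_forall fun x => ?_)
  rw [Real.norm_of_nonneg (Real.rpow_nonneg (abs_nonneg _) _)]
  exact hb _

theorem IsFinslerMinkowskiNorm.memLp_rpow_smul_gradient {n : ℕ} {H : E n → ℝ}
    (hH : IsFinslerMinkowskiNorm H) {p q : ℝ} (hpq : p.HolderConjugate q) {G : E n → E n}
    (hG : MemLp G (ENNReal.ofReal p)) :
    MemLp (fun x => H (G x) ^ (p - 1) • gradient H (G x)) (ENNReal.ofReal q) := by
  obtain ⟨K, hK0, hK⟩ := hH.exists_norm_gradient_le
  obtain ⟨C₁, C₂, -, hC₂, hb⟩ := hH.bounds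
  have hp1 := hpq.sub_one_pos
  refine (memLp_rpow_sub_one hpq hG.norm).of_le_mul (c := C₂ ^ (p - 1) * K) ?_
    (Eventually.of_forall fun x => ?_)
  · have h1 : Measurable fun ξ : E n => H ξ ^ (p - 1) • gradient H ξ :=
      (hH.continuous.measurable.pow_const _).smul (measurable_gradient H)
    exact (h1.comp_aemeasurable hG.1.aemeasurable).aestronglyMeasurable
  · have h0 := Real.rpow_nonneg (hH.nonneg (G x)) (p - 1)
    rw [norm_smul, Real.norm_of_nonneg h0,
      Real.norm_of_nonneg (Real.rpow_nonneg (abs_nonneg _) _), abs_norm]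
    calc _ ≤ (C₂ * ‖G x‖) ^ (p - 1) * K := by
          gcongr
          · exact hH.nonneg _
          · exact (hb _).2
          · exact hK _
      _ = _ := by rw [Real.mul_rpow hC₂.le (norm_nonneg _)]; ring

/-! ### Testing the equation with a displacement -/

theorem contDiff_comp_deform_sub {n : ℕ} {R : ℝ} (hR : 0 < R) (t : ℝ) {w : E n → ℝ}
    (hw : ContDiff ℝ 1 w) : ContDiff ℝ 1 (fun x => w (deform R t x) - w x) :=
  (hw.comp (contDiff_deform hR t)).sub hw

theorem hasCompactSupport_comp_deform_sub {n : ℕ} {R : ℝ} (hR : 0 < R) (t : ℝ) (w : E n → ℝ) :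
    HasCompactSupport (fun x => w (deform R t x) - w x) := by
  refine HasCompactSupport.intro (isCompact_closedBall (0 : E n) (2 * R)) fun x hx => ?_
  rw [mem_closedBall_zero_iff, not_le] at hx
  rw [deform_of_le_norm hR t hx.le, sub_self]

theorem gradient_comp_deform_sub {n : ℕ} {R : ℝ} (hR : 0 < R) (t : ℝ) {w : E n → ℝ}
    (hw : ContDiff ℝ 1 w) (x : E n) :
    gradient (fun y => w (deform R t y) - w y) x =
      pullbackGrad R t (gradient w) x - gradient w x := by
  have h1 : DifferentiableAt ℝ (fun y => w (deform R t y)) x :=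
    (hw.comp (contDiff_deform hR t)).differentiable one_ne_zero x
  rw [← gradient_comp_deform hR t hw, gradient, gradient, gradient, ← map_sub,
    fderiv_fun_sub h1 (hw.differentiable one_ne_zero x)]

/-- The weak formulation for a `C¹` function moved along the truncated field, in terms of the
weighted difference quotients. -/
theorem IsWeakSolution.test_deform_of_contDiff {n : ℕ} {H : E n → ℝ} {s p α β : ℝ} (hp : 1 < p)
    {f : ℝ → ℝ} {u : E n → ℝ} (h : IsWeakSolution H s p α β f u) {R : ℝ} (hR : 0 < R) (t : ℝ)
    {w : E n → ℝ} (hw : ContDiff ℝ 1 w) :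
    α * (∫ x, ⟪H (weakGradient u x) ^ (p - 1) • gradient H (weakGradient u x),
        pullbackGrad R t (gradient w) x - gradient w x⟫) +
      β * (∫ z, J p (diffQuot ((n : ℝ) / p + s) u z) *
        (diffQuot ((n : ℝ) / p + s) (fun x => w (deform R t x)) z -
          diffQuot ((n : ℝ) / p + s) w z)) =
      ∫ x, f (u x) * (w (deform R t x) - w x) := by
  rw [← h _ (contDiff_comp_deform_sub hR t hw) (hasCompactSupport_comp_deform_sub hR t w)]
  simp only [inner_smul_left, gradient_comp_deform_sub hR t hw]
  congr 2
  refine integral_congr_ae (Eventually.of_forall fun z => ?_)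
  simp only
  rw [← diffQuot_sub]
  exact (J_pairing_eq hp u (fun x => w (deform R t x) - w x) z).symm

/-- A solution in `W^{1,p}` may be tested with its own displacement along the truncated field. The
displacements of its mollifications are admissible and converge to it in every norm involved. -/
theorem IsWeakSolution.test_deform_of_mem_sobolevW1 {n : ℕ} {H : E n → ℝ}
    (hH : IsFinslerMinkowskiNorm H) {s p α β : ℝ} (hs : 0 < s) (hp : 1 < p)
    {f : ℝ → ℝ} (hf : Continuous f) (hf₁ : ∃ C : ℝ, 0 < C ∧ ∀ t, |f t| ≤ C * |t| ^ (p - 1))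
    {u : E n → ℝ} (h : IsWeakSolution H s p α β f u) (hu : u ∈ sobolevW1 n p)
    (hβ : β = 0 ∨ u ∈ sobolevWs n s p) {c R t : ℝ} (hc : DeformBound n c) (hR : 0 < R)
    (ht : c * |t| ≤ 1 / 2) :
    α * (∫ x, ⟪H (weakGradient u x) ^ (p - 1) • gradient H (weakGradient u x),
        pullbackGrad R t (weakGradient u) x - weakGradient u x⟫) +
      β * (∫ z, J p (diffQuot ((n : ℝ) / p + s) u z) *
        (diffQuot ((n : ℝ) / p + s) (fun x => u (deform R t x)) z -
          diffQuot ((n : ℝ) / p + s) u z)) =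
      ∫ x, f (u x) * (u (deform R t x) - u x) := by
  obtain ⟨q, hpq⟩ : ∃ q, p.HolderConjugate q := ⟨_, Real.HolderConjugate.conjExponent hp⟩
  obtain ⟨hG, hGp⟩ := isWeakGradient_weakGradient hu
  have hup := hu.1
  set G := weakGradient u with hGdef
  set κ := (n : ℝ) / p + s with hκ
  have hκ0 : 0 ≤ κ := by
    have : 0 ≤ (n : ℝ) / p := by positivity
    linarith
  have hP1 : 1 ≤ ENNReal.ofReal p := by simpa using hp.le
  set uk := fun k => mollify (bumpSeq n k) u with huk
  have hukc : ∀ k, ContDiff ℝ 1 (uk k) := fun k => contDiff_mollify _ hG.1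
  have hukm : ∀ k, AEStronglyMeasurable (uk k) volume := fun k =>
    (hukc k).continuous.aestronglyMeasurable
  have hgrad : ∀ k, gradient (uk k) = mollify (bumpSeq n k) G := fun k =>
    funext fun x => gradient_mollify _ hG x
  have hgm : ∀ k, AEStronglyMeasurable (gradient (uk k)) volume := fun k =>
    ((InnerProductSpace.toDual ℝ (E n)).symm.continuous.comp
      ((hukc k).continuous_fderiv one_ne_zero)).aestronglyMeasurable
  have hcv := hc.isChangeOfVariables hR ht
  have hum : AEStronglyMeasurable (fun x => u (deform R t x)) volume := (hcv.memLp_comp hp.le hup).1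
  have hukdm : ∀ k, AEStronglyMeasurable (fun x => uk k (deform R t x)) volume := fun k =>
    ((hukc k).continuous.comp (continuous_deform hR t)).aestronglyMeasurable
  -- convergence of the source term
  have L1 : Tendsto (fun k => ∫ x, f (u x) * (uk k (deform R t x) - uk k x)) atTop
      (𝓝 (∫ x, f (u x) * (u (deform R t x) - u x))) := by
    refine tendsto_integral_bilin hpq (ContinuousLinearMap.mul ℝ ℝ)
      (memLp_comp_of_growth hpq hf hf₁ hup) ((hcv.memLp_comp hp.le hup).sub hup)
      (fun k => (hukdm k).sub (hukm k)) ?_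
    refine tendsto_of_le_mul (C := 5) (by simp)
      (tendsto_eLpNorm_mollify_bumpSeq_sub hp.le hup) fun k => ?_
    have e : (fun x => uk k (deform R t x) - uk k x - (u (deform R t x) - u x)) =
        (fun x => uk k (deform R t x) - u (deform R t x)) - fun x => uk k x - u x := by
      funext x; simp only [Pi.sub_apply]; ring
    rw [e]
    refine (eLpNorm_sub_le ((hukdm k).sub hum) ((hukm k).sub hup.1) hP1).trans ?_
    rw [show (5 : ENNReal) = 4 + 1 by norm_num, add_mul, one_mul]
    exact add_le_add (hcv.eLpNorm_comp_le hp.le (g := fun x => uk k x - u x)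
      ((hukm k).sub hup.1)) le_rfl
  -- convergence of the local term
  have L2 : Tendsto (fun k => ∫ x, ⟪H (G x) ^ (p - 1) • gradient H (G x),
      pullbackGrad R t (gradient (uk k)) x - gradient (uk k) x⟫) atTop
      (𝓝 (∫ x, ⟪H (G x) ^ (p - 1) • gradient H (G x), pullbackGrad R t G x - G x⟫)) := by
    refine tendsto_integral_bilin hpq (innerSL ℝ (E := E n))
      (hH.memLp_rpow_smul_gradient hpq hGp) ((memLp_pullbackGrad hc hR ht hp.le hGp).sub hGp)
      (fun k => (aestronglyMeasurable_pullbackGrad hc hR ht (hgm k)).sub (hgm k)) ?_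
    refine tendsto_of_le_mul (C := 9) (by simp)
      (tendsto_eLpNorm_mollify_bumpSeq_sub hp.le hGp) fun k => ?_
    have hd : AEStronglyMeasurable (fun x => gradient (uk k) x - G x) volume := (hgm k).sub hGp.1
    have e : (fun x => pullbackGrad R t (gradient (uk k)) x - gradient (uk k) x -
        (pullbackGrad R t G x - G x)) =
        pullbackGrad R t (fun x => gradient (uk k) x - G x) -
          fun x => gradient (uk k) x - G x := by
      funext x; simp only [Pi.sub_apply, pullbackGrad, map_sub]; abel
    rw [e]
    refine (eLpNorm_sub_le (aestronglyMeasurable_pullbackGrad hc hR ht hd) hd hP1).trans ?_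
    rw [show (9 : ENNReal) = 8 + 1 by norm_num, add_mul, one_mul, ← hgrad k]
    exact add_le_add (eLpNorm_pullbackGrad_le hc hR ht hp.le hd) le_rfl
  -- convergence of the nonlocal term
  have L3 : Tendsto (fun k => β * ∫ z, J p (diffQuot κ u z) *
      (diffQuot κ (fun x => uk k (deform R t x)) z - diffQuot κ (uk k) z)) atTop
      (𝓝 (β * ∫ z, J p (diffQuot κ u z) *
        (diffQuot κ (fun x => u (deform R t x)) z - diffQuot κ u z))) := by
    rcases hβ with rfl | hW
    · simp
    refine Tendsto.const_mul β ?_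
    have hD := memLp_diffQuot hW
    refine tendsto_integral_bilin hpq (ContinuousLinearMap.mul ℝ ℝ) (memLp_J_comp hpq hD)
      ((memLp_diffQuot_comp_deform hc hR ht hp.le hκ0 hup.1 hD).sub hD)
      (fun k => (aestronglyMeasurable_diffQuot κ (hukdm k)).sub
        (aestronglyMeasurable_diffQuot κ (hukm k))) ?_
    refine tendsto_of_le_mul (C := ENNReal.ofReal (2 ^ κ) * 4 + 1)
      (by finiteness) (tendsto_eLpNorm_diffQuot_mollify_sub hp.le hG.1 hD) fun k => ?_
    have hdm : AEStronglyMeasurable (fun x => uk k x - u x) volume := (hukm k).sub hup.1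
    have e : (fun z => diffQuot κ (fun x => uk k (deform R t x)) z - diffQuot κ (uk k) z -
        (diffQuot κ (fun x => u (deform R t x)) z - diffQuot κ u z)) =
        diffQuot κ (fun x => uk k (deform R t x) - u (deform R t x)) -
          diffQuot κ (fun x => uk k x - u x) := by
      funext z; simp only [Pi.sub_apply, diffQuot_sub]; ring
    rw [e]
    refine (eLpNorm_sub_le (aestronglyMeasurable_diffQuot κ ((hukdm k).sub hum))
      (aestronglyMeasurable_diffQuot κ hdm) hP1).trans ?_
    have e2 : diffQuot κ (fun x => uk k x - u x) =
        fun z => diffQuot κ (mollify (bumpSeq n k) u) z - diffQuot κ u z :=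
      funext fun z => diffQuot_sub κ _ _ z
    rw [add_mul, one_mul, mul_assoc, ← e2]
    exact add_le_add (eLpNorm_diffQuot_comp_deform_le (u := fun x => uk k x - u x)
      hc hR ht hp.le hκ0 hdm) le_rfl
  refine tendsto_nhds_unique ((L2.const_mul α).add L3) ?_
  refine L1.congr fun k => ?_
  exact (h.test_deform_of_contDiff hp hR t (hukc k)).symm

/-! ### The Pohozaev identity -/

/-- Convexity of the anisotropic energy, in integrated form. -/
theorem mul_integral_finsler_le {n : ℕ} {H : E n → ℝ} (hH : IsFinslerMinkowskiNorm H) {p : ℝ}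
    (hp : 1 < p) {G V : E n → E n} (hG : MemLp G (ENNReal.ofReal p))
    (hV : MemLp V (ENNReal.ofReal p)) :
    p * ∫ x, ⟪H (G x) ^ (p - 1) • gradient H (G x), V x - G x⟫ ≤
      (∫ x, H (V x) ^ p) - ∫ x, H (G x) ^ p := by
  have hpq := Real.HolderConjugate.conjExponent hp
  have hi := integrable_bilin hpq (innerSL ℝ (E := E n)) (hH.memLp_rpow_smul_gradient hpq hG)
    (hV.sub hG)
  have h1 := hH.integrable_rpow hp hV
  have h2 := hH.integrable_rpow hp hG
  rw [← integral_sub h1 h2, ← integral_const_mul]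
  refine integral_mono (hi.const_mul p) (h1.sub h2) fun x => ?_
  have := hH.rpow_convexity hp (G x) (V x)
  simpa [inner_smul_left] using this

/-- Convexity of the Gagliardo energy, in integrated form. -/
theorem mul_integral_J_le {Y : Type*} [MeasurableSpace Y] {μ : Measure Y} {p : ℝ}
    (hp : 1 < p) {g v : Y → ℝ} (hg : MemLp g (ENNReal.ofReal p) μ)
    (hv : MemLp v (ENNReal.ofReal p) μ) :
    p * ∫ x, J p (g x) * (v x - g x) ∂μ ≤ (∫ x, |v x| ^ p ∂μ) - ∫ x, |g x| ^ p ∂μ := by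
  have hpq := Real.HolderConjugate.conjExponent hp
  have hi := integrable_bilin hpq (ContinuousLinearMap.mul ℝ ℝ) (memLp_J_comp hpq hg) (hv.sub hg)
  have hpow : ∀ {w : Y → ℝ}, MemLp w (ENNReal.ofReal p) μ → Integrable (fun x => |w x| ^ p) μ :=
    fun {w} hw => by
      have hi := hw.integrable_norm_rpow (by simp; linarith) ENNReal.ofReal_ne_top
      rwa [ENNReal.toReal_ofReal (by linarith)] at hi
  rw [← integral_sub (hpow hv) (hpow hg), ← integral_const_mul]
  exact integral_mono (hi.const_mul p) ((hpow hv).sub (hpow hg)) fun x =>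
    J_convexity hp (g x) (v x)

/-- Convexity of the energy along the deformation: the energy increment dominates the action of
the source on the displacement. -/
theorem IsWeakSolution.integral_le_energy_sub {n : ℕ} {H : E n → ℝ}
    (hH : IsFinslerMinkowskiNorm H) {s p α β : ℝ} (hs : 0 < s) (hp : 1 < p) (hα : 0 ≤ α)
    (hβ : 0 ≤ β) {f : ℝ → ℝ} (hf : Continuous f)
    (hf₁ : ∃ C : ℝ, 0 < C ∧ ∀ t, |f t| ≤ C * |t| ^ (p - 1))
    {u : E n → ℝ} (h : IsWeakSolution H s p α β f u) (hup : MemLp u (ENNReal.ofReal p))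
    (hβu : β = 0 ∨ u ∈ sobolevWs n s p) (hu : u ∈ sobolevW1 n p ∨ α = 0 ∧ ContDiff ℝ 1 u)
    {c R t : ℝ} (hc : DeformBound n c) (hR : 0 < R) (ht : c * |t| ≤ 1 / 2) :
    p * ∫ x, f (u x) * (u (deform R t x) - u x) ≤
      α * ((∫ x, H (pullbackGrad R t (weakGradient u) x) ^ p) - ∫ x, H (weakGradient u x) ^ p) +
      β * ((∫ z, |diffQuot ((n : ℝ) / p + s) (fun x => u (deform R t x)) z| ^ p) -
        ∫ z, |diffQuot ((n : ℝ) / p + s) u z| ^ p) := by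
  have hκ0 : 0 ≤ (n : ℝ) / p + s := by
    have : 0 ≤ (n : ℝ) / p := by positivity
    linarith
  have hnl : β * (p * ∫ z, J p (diffQuot ((n : ℝ) / p + s) u z) *
        (diffQuot ((n : ℝ) / p + s) (fun x => u (deform R t x)) z -
          diffQuot ((n : ℝ) / p + s) u z)) ≤
      β * ((∫ z, |diffQuot ((n : ℝ) / p + s) (fun x => u (deform R t x)) z| ^ p) -
        ∫ z, |diffQuot ((n : ℝ) / p + s) u z| ^ p) := by
    rcases hβu with rfl | hW
    · simp
    · have hD := memLp_diffQuot hW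
      refine mul_le_mul_of_nonneg_left (mul_integral_J_le hp hD ?_) hβ
      exact memLp_diffQuot_comp_deform hc hR ht hp.le hκ0 hup.1 hD
  rcases hu with hu | ⟨rfl, hu⟩
  · obtain ⟨-, hGp⟩ := isWeakGradient_weakGradient hu
    have hl := mul_le_mul_of_nonneg_left
      (mul_integral_finsler_le hH hp hGp (memLp_pullbackGrad hc hR ht hp.le hGp)) hα
    rw [← h.test_deform_of_mem_sobolevW1 hH hs hp hf hf₁ hu hβu hc hR ht]
    linarith
  · rw [← h.test_deform_of_contDiff hp hR t hu]
    linarith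

/-- The integrated first-order expansion: `∫ F(u ∘ Φ) - ∫ F(u)` and the action of `f(u)` on the
displacement agree to first order. -/
theorem exists_abs_integral_primitive_comp_deform_sub_le {n : ℕ} {p : ℝ} (hp : 1 < p)
    {f : ℝ → ℝ} (hf : Continuous f) (hf₁ : ∃ C : ℝ, 0 < C ∧ ∀ t, |f t| ≤ C * |t| ^ (p - 1))
    {u : E n → ℝ} (hup : MemLp u (ENNReal.ofReal p)) (hu : u ∈ sobolevW1 n p ∨ ContDiff ℝ 1 u)
    {c R : ℝ} (hc : DeformBound n c) (hR : 0 < R) {ε : ℝ} (hε : 0 < ε) :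
    ∃ δ > 0, ∀ t, |t| ≤ δ → c * |t| ≤ 1 / 2 →
      |(∫ x, ∫ τ in (0 : ℝ)..u (deform R t x), f τ) - (∫ x, ∫ τ in (0 : ℝ)..u x, f τ) -
        ∫ x, f (u x) * (u (deform R t x) - u x)| ≤ ε * |t| := by
  have hpq := Real.HolderConjugate.conjExponent hp
  obtain ⟨K, hK0, hK⟩ := exists_eLpNorm_comp_deform_sub_le hc hR hp.le hu
  obtain ⟨δ, hδ, h⟩ := exists_abs_integral_primitive_sub_le hp hf hf₁ hup
    (S := Metric.closedBall (0 : E n) (2 * R)) Metric.isClosed_closedBall.measurableSet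
    (isCompact_closedBall (0 : E n) (2 * R)).measure_lt_top.ne hK0 hε
  refine ⟨δ, hδ, fun t ht htc => ?_⟩
  have hv : MemLp (fun x => u (deform R t x)) (ENNReal.ofReal p) :=
    (hc.isChangeOfVariables hR htc).memLp_comp hp.le hup
  have hmain := h t ht (fun x => u (deform R t x) - u x) (hv.sub hup) (fun x hx => by
    rw [mem_closedBall_zero_iff, not_le] at hx
    rw [deform_of_le_norm hR t hx.le, sub_self]) (hK t htc)
  simp only [add_sub_cancel] at hmain
  have hi₁ := integrable_primitive_comp hp hf hf₁ hv
  have hi₂ := integrable_primitive_comp hp hf hf₁ hup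
  have hi₃ : Integrable fun x => f (u x) * (u (deform R t x) - u x) :=
    integrable_bilin hpq (ContinuousLinearMap.mul ℝ ℝ) (memLp_comp_of_growth hpq hf hf₁ hup)
      (hv.sub hup)
  have hi₁₂ : Integrable fun x =>
    (∫ τ in (0 : ℝ)..u (deform R t x), f τ) - ∫ τ in (0 : ℝ)..u x, f τ := hi₁.sub hi₂
  rwa [integral_sub hi₁₂ hi₃, integral_sub hi₁ hi₂] at hmain

/-- The Pohozaev identity, for nonnegative coefficients and for functions that are either in
`W^{1,p}` or, in the absence of the local term, of class `C¹`. -/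
theorem IsWeakSolution.pohozaev {n : ℕ} {H : E n → ℝ}
    (hH : IsFinslerMinkowskiNorm H) {s p α β : ℝ} (hs : 0 < s) (hp : 1 < p) (hα : 0 ≤ α)
    (hβ : 0 ≤ β) {f : ℝ → ℝ} (hf : Continuous f)
    (hf₁ : ∃ C : ℝ, 0 < C ∧ ∀ t, |f t| ≤ C * |t| ^ (p - 1))
    {u : E n → ℝ} (h : IsWeakSolution H s p α β f u) (hup : MemLp u (ENNReal.ofReal p))
    (hβu : β = 0 ∨ u ∈ sobolevWs n s p) (hu : u ∈ sobolevW1 n p ∨ α = 0 ∧ ContDiff ℝ 1 u) :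
    α * (n - p) / p * anisotropicEnergy H p u + β * (n - s * p) / p * gagliardoEnergy s p u =
      n * ∫ x, (∫ t in (0 : ℝ)..u x, f t) := by
  have hp0 : 0 < p := by linarith
  obtain ⟨c, hc⟩ := exists_deformBound n
  have hc0 : 0 < c := zero_lt_one.trans_le hc.one_le
  rw [gagliardoEnergy_eq hp, anisotropicEnergy]
  set κ := (n : ℝ) / p + s with hκ
  have hκp : κ * p - 2 * n = s * p - n := by
    rw [hκ]; field_simp; ring
  set A := ∫ x, H (weakGradient u x) ^ p with hA
  set B := ∫ z, |diffQuot κ u z| ^ p with hB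
  set I := ∫ x, (∫ t in (0 : ℝ)..u x, f t) with hI
  -- `D` is the defect, multiplied by `p`; it is bounded by every positive number
  set D := α * (p - n) * A + β * (s * p - n) * B + p * n * I with hD
  suffices hD0 : D = 0 by
    field_simp
    linarith
  have hFi := integrable_primitive_comp hp hf hf₁ hup
  have key : ∀ ε > 0, |D| ≤ (α + β + 2 * p) * ε := by
    intro ε hε
    have loc : ∃ R₀ > 0, ∃ δ > 0, ∀ R ≥ R₀, ∀ t, |t| ≤ δ →
        α * ((∫ x, H (pullbackGrad R t (weakGradient u) x) ^ p) - A) ≤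
          α * (t * (p - n) * A + ε * |t|) := by
      rcases hu with hu | ⟨rfl, -⟩
      · obtain ⟨R₀, hR₀, δ, hδ, hb⟩ := exists_abs_integral_finsler_pullback_sub_le hc hH hp
          (isWeakGradient_weakGradient hu).2 hε
        refine ⟨R₀, hR₀, δ, hδ, fun R hR t ht => mul_le_mul_of_nonneg_left ?_ hα⟩
        have := (abs_le.1 (hb R hR t ht)).2
        linarith
      · exact ⟨1, one_pos, 1, one_pos, fun R _ t _ => by simp⟩
    have nonloc : ∃ R₀ > 0, ∃ δ > 0, ∀ R ≥ R₀, ∀ t, |t| ≤ δ →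
        β * ((∫ z, |diffQuot κ (fun x => u (deform R t x)) z| ^ p) - B) ≤
          β * (t * (s * p - n) * B + ε * |t|) := by
      rcases hβu with rfl | hW
      · exact ⟨1, one_pos, 1, one_pos, fun R _ t _ => by simp⟩
      · obtain ⟨R₀, hR₀, δ, hδ, hb⟩ := exists_abs_integral_diffQuot_deform_sub_le hc hp hup.1
          (memLp_diffQuot hW) hε
        refine ⟨R₀, hR₀, δ, hδ, fun R hR t ht => mul_le_mul_of_nonneg_left ?_ hβ⟩
        have := (abs_le.1 (hb R hR t ht)).2
        rw [← hκ, hκp] at this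
        linarith
    obtain ⟨R₁, hR₁, δ₁, hδ₁, h₁⟩ := loc
    obtain ⟨R₂, hR₂, δ₂, hδ₂, h₂⟩ := nonloc
    obtain ⟨R₃, hR₃, δ₃, hδ₃, h₃⟩ := exists_abs_integral_comp_deform_sub_le hc hFi hε
    set R := max R₁ (max R₂ R₃) with hR
    have hR0 : 0 < R := hR₁.trans_le (le_max_left _ _)
    obtain ⟨δ₄, hδ₄, h₄⟩ := exists_abs_integral_primitive_comp_deform_sub_le hp hf hf₁ hup
      (hu.imp_right And.right) hc hR0 hε
    -- energy, potential and source are compared at time `t`; used below for both signs of `t`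
    have hstep : ∀ t, |t| ≤ δ₁ → |t| ≤ δ₂ → |t| ≤ δ₃ → |t| ≤ δ₄ → c * |t| ≤ 1 / 2 →
        -(t * D) ≤ (α + β + 2 * p) * ε * |t| := by
      intro t ht₁ ht₂ ht₃ ht₄ htc
      have e₁ := h₁ R (le_max_left _ _) t ht₁
      have e₂ := h₂ R ((le_max_left _ _).trans (le_max_right _ _)) t ht₂
      have e₃ := (abs_le.1 (h₃ R ((le_max_right _ _).trans (le_max_right _ _)) t ht₃)).1
      have e₄ := (abs_le.1 (h₄ t ht₄ htc)).2
      have e₅ := h.integral_le_energy_sub hH hs hp hα hβ hf hf₁ hup hβu hu hc hR0 htc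
      have e₆ : -(t * n * I) - 2 * (ε * |t|) ≤ ∫ x, f (u x) * (u (deform R t x) - u x) := by
        rw [← hI] at e₄ e₃
        linarith
      have e₇ := mul_le_mul_of_nonneg_left e₆ hp0.le
      rw [hD]
      linarith
    set τ := min (min δ₁ δ₂) (min (min δ₃ δ₄) (1 / (2 * c))) with hτ
    have hτ0 : 0 < τ := by positivity
    have b₁ : τ ≤ δ₁ := (min_le_left _ _).trans (min_le_left _ _)
    have b₂ : τ ≤ δ₂ := (min_le_left _ _).trans (min_le_right _ _)
    have b₃ : τ ≤ δ₃ := (min_le_right _ _).trans ((min_le_left _ _).trans (min_le_left _ _))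
    have b₄ : τ ≤ δ₄ := (min_le_right _ _).trans ((min_le_left _ _).trans (min_le_right _ _))
    have b₅ : c * τ ≤ 1 / 2 := by
      have : τ ≤ 1 / (2 * c) := (min_le_right _ _).trans (min_le_right _ _)
      rw [le_div_iff₀ (by positivity)] at this
      linarith
    have hpos := hstep τ
    have hneg := hstep (-τ)
    rw [abs_of_pos hτ0] at hpos
    rw [abs_neg, abs_of_pos hτ0] at hneg
    have hpos := hpos b₁ b₂ b₃ b₄ b₅
    have hneg := hneg b₁ b₂ b₃ b₄ b₅
    rw [abs_le]
    constructor <;> nlinarith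
  by_contra hne
  have hC : 0 < α + β + 2 * p := by linarith
  have hpos : 0 < |D| := abs_pos.2 hne
  have := key (|D| / (2 * (α + β + 2 * p))) (by positivity)
  have e : (α + β + 2 * p) * (|D| / (2 * (α + β + 2 * p))) = |D| / 2 := by field_simp
  linarith

end Pohozaev

end

theorem theorem2p1 (n : ℕ) (hn : 1 ≤ n) (s p : ℝ) (hs0 : 0 < s) (hs1 : s < 1) (hp : 1 < p)
    (H : E n → ℝ) (hH : IsFinslerMinkowskiNorm H)
    (α β : ℝ) (hαβ : (α, β) ∈ admissible)
    (f : ℝ → ℝ) (hf : Continuous f) (hf₁ : ∃ C : ℝ, 0 < C ∧ ∀ t, |f t| ≤ C * |t| ^ (p - 1))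
    (u : E n → ℝ) (hu : u ∈ solutionSpace n s p α β) (hsol : IsWeakSolution H s p α β f u) :
    Integrable (fun x => ∫ t in (0 : ℝ)..u x, f t) ∧
      α * (n - p) / p * anisotropicEnergy H p u + β * (n - s * p) / p * gagliardoEnergy s p u =
        n * ∫ x, (∫ t in (0 : ℝ)..u x, f t) := by
  obtain ⟨hα, hβ, hup, hβu, hu'⟩ : 0 ≤ α ∧ 0 ≤ β ∧ MemLp u (ENNReal.ofReal p) ∧
      (β = 0 ∨ u ∈ sobolevWs n s p) ∧ (u ∈ sobolevW1 n p ∨ α = 0 ∧ ContDiff ℝ 1 u) := by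
    rcases hu with ⟨rfl, rfl, hu⟩ | ⟨rfl, hβ, ⟨hu, hus⟩, -⟩ | ⟨rfl, rfl, ⟨hus, hu⟩ | ⟨hu, hus⟩⟩
    · exact ⟨zero_le_one, le_rfl, hu.1, Or.inl rfl, Or.inl hu⟩
    · exact ⟨zero_le_one, hβ.le, hu.1, Or.inr hus, Or.inl hu⟩
    · exact ⟨le_rfl, zero_le_one, hus.1, Or.inr hus, Or.inr ⟨rfl, hu.1⟩⟩
    · exact ⟨le_rfl, zero_le_one, hu.1, Or.inr hus, Or.inl hu⟩
  exact ⟨integrable_primitive_comp hp hf hf₁ hup,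
    hsol.pohozaev hH hs0 hp hα hβ hf hf₁ hup hβu hu'⟩
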